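/- Notation. Rows $[z(D)\,|\,x(D)]$ of $2N$ binary Laurent polynomials describe, up to phase, finite-weight Pauli sequences on a stream of frames of $N$ qubits: the coefficient of $D^t$ in $z_q$ (in $x_q$) is the exponent of $Z$ (of $X$) on qubit $q$ of frame $t$; infinite-weight sequences have entries in $\mathbb F_2(D)$. Two finite-weight sequences commute with all shifts of each other iff their shifted symplectic product $z(D)\cdot x'(D^{-1})+x(D)\cdot z'(D^{-1})$ vanishes. The *finite-depth* shift-invariant Clifford operations, repeated in every frame, are: CNOT from qubit $i$ to qubit $j\ne i$ in a frame delayed by $k\in\mathbb Z$; Hadamard; phase gate; controlled-phase from qubit $i$ to qubit $j$ (or to $i$ itself, $k\neq 0$) in a frame delayed by $k$; delay of a qubit by $l\in\mathbb Z$ frames. An *infinite-depth* operation $1/f(D)$ on qubit $i$, with $f\in\mathbb F_2[D]$, $f(0)=1$, multiplies $x_i$ by $1/f(D)$ and $z_i$ by $f(D^{-1})$; it is performed online by a running cascade of CNOTs from earlier frames into the present one. A circuit is a finite list of such operations. An $[[n,k;c]]$ entanglement-assisted quantum convolutional code starts, in each frame, from $c$ ebits shared by sender and receiver (stabilized by $ZZ$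 and $XX$), and $n-k-c$ ancilla qubits (stabilized by $Z$) and $k$ information qubits of the sender, who thus holds $n$ qubits per frame. The sender applies an online encoding circuit of the above operations to her $n$ qubits only. The receiver, holding all $n+c$ qubits, applies a decoding circuit of finite-depth operations only; encoding followed by decoding takes the operators $Z$ and $X$ of each information qubit to the operators $Z$ and $X$ of an output qubit, up to multiplication by finite products of shifted generators of the decoded stabilizer. The code *realizes* a quantum check matrix $H(D)$ with $2n$ columns if there are finite-weight Pauli sequences on the $c+n$ qubits per frame, with vanishing mutual shifted symplectic products, whose parts on the sender's qubits are the rows of $H(D)$, and which arise from the encoded stabilizer generators by a matrix $R(D)$ of Laurent polynomials that is invertible over $\mathbb F_2(D)$. Theorem. Let $k_1,k_2\le n$ and let $H_1(D)$, $H_2(D)$ be binary polynomial matrices of sizes $(n-k_1)\times n$ and $(n-k_2)\times n$, check matrices of two classical binary convolutional codes, each of them noncatastrophic (if $u(D)H_i(D)$ has finite weight for a row $u(D)$ of power series, then $u(D)$ has finite weight) and delay-free ($H_i(0)$ has full row rank). Let $c$ be the rank of $H_1(D)H_2^T(D^{-1})$ over $\mathbb F_2(D)$. Then $k_1+k_2-n+c\ge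 0$, and there is an $[[n,\,k_1+k_2-n+c;\,c]]$ entanglement-assisted quantum convolutional code, with an online encoding circuit of finite-depth and possibly infinite-depth operations and a finite-depth decoding circuit, that realizes the CSS quantum check matrix $$\left[\begin{array}{c|c} H_1(D) & 0\\ 0 & H_2(D)\end{array}\right].$$ If moreover $H_1(D)H_2^T(D^{-1})=A(D)\begin{bmatrix}\Gamma(D)&0\\0&0\end{bmatrix}B(D)$ with $A(D),B(D)$ invertible over the binary Laurent polynomials and $\Gamma(D)$ a $c\times c$ diagonal matrix of powers of $D$, then such a code exists whose encoding circuit has finite-depth operations only. -/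

import Mathlib

open scoped Polynomial LaurentPolynomial

noncomputable section

namespace EAQC

/-- Binary Laurent polynomials in the delay `D` (written `T` in Mathlib). A Laurent polynomial is
a finite-weight binary sequence indexed by the frames `t ∈ ℤ`. -/
abbrev BLaurent : Type := (ZMod 2)[T;T⁻¹]

/-- Binary rational functions in the delay `D`. -/
abbrev BRat : Type := FractionRing BLaurent

/-- The inclusion of Laurent polynomials into rational functions. -/
def toRat : BLaurent →+* BRat := algebraMap BLaurent BRat

/-- The power `D ^ l`, for `l ∈ ℤ`, as a rational function. -/
def delayPow (l : ℤ) : BRat := toRat (LaurentPolynomial.T l)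

/-! ### Classical convolutional codes -/

/-- A polynomial matrix `H(D)` is noncatastrophic if an input stream `u(D)` (a row of power series)
whose output `u(D) H(D)` has finite weight has finite weight itself. -/
def Noncatastrophic {r n : ℕ} (H : Matrix (Fin r) (Fin n) (ZMod 2)[X]) : Prop :=
  ∀ u : Fin r → PowerSeries (ZMod 2),
    (∀ j, ∃ p : (ZMod 2)[X], (p : PowerSeries (ZMod 2)) =
      ∑ i, u i * (H i j : PowerSeries (ZMod 2))) →
    ∀ i, ∃ p : (ZMod 2)[X], (p : PowerSeries (ZMod 2)) = u i

/-- A polynomial matrix `H(D)` is delay-free if `H(0)` has full row rank. -/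
def DelayFree {r n : ℕ} (H : Matrix (Fin r) (Fin n) (ZMod 2)[X]) : Prop :=
  LinearIndependent (ZMod 2) fun i : Fin r => fun j : Fin n => (H i j).coeff 0

/-- `H(D)` as a matrix of Laurent polynomials. -/
def toLaurentMatrix {r n : ℕ} (H : Matrix (Fin r) (Fin n) (ZMod 2)[X]) :
    Matrix (Fin r) (Fin n) BLaurent :=
  H.map Polynomial.toLaurent

/-- The matrix `H₁(D) H₂ᵀ(D⁻¹)`. -/
def overlap {r₁ r₂ n : ℕ} (H₁ : Matrix (Fin r₁) (Fin n) (ZMod 2)[X])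
    (H₂ : Matrix (Fin r₂) (Fin n) (ZMod 2)[X]) : Matrix (Fin r₁) (Fin r₂) BLaurent :=
  toLaurentMatrix H₁ * ((toLaurentMatrix H₂).map LaurentPolynomial.invert).transpose

/-- The rank of a matrix of Laurent polynomials over the field of rational functions. -/
def ratRank {r₁ r₂ : ℕ} (P : Matrix (Fin r₁) (Fin r₂) BLaurent) : ℕ :=
  (P.map toRat).rank

/-- The `r₁ × r₂` matrix `diag(Γ(D), 0)` where `Γ(D)` is the `c × c` diagonal matrix with the
powers `D ^ (e 0), …, D ^ (e (c - 1))` of `D` on its diagonal. -/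
def monomialDiagonal (r₁ r₂ c : ℕ) (e : ℕ → ℤ) : Matrix (Fin r₁) (Fin r₂) BLaurent :=
  fun i j => if i.val = j.val ∧ i.val < c then LaurentPolynomial.T (e i.val) else 0

/-- `P(D) = A(D) diag(Γ(D), 0) B(D)` with `A(D)`, `B(D)` invertible over the Laurent polynomials
and `Γ(D)` a `c × c` diagonal matrix whose diagonal entries are powers of `D`. -/
def HasMonomialSmithForm {r₁ r₂ : ℕ} (P : Matrix (Fin r₁) (Fin r₂) BLaurent) (c : ℕ) : Prop :=
  ∃ (A : Matrix (Fin r₁) (Fin r₁) BLaurent) (B : Matrix (Fin r₂) (Fin r₂) BLaurent)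
    (e : ℕ → ℤ), IsUnit A ∧ IsUnit B ∧
    P = A * monomialDiagonal r₁ r₂ c e * B

/-! ### Pauli sequences and their commutation relations

`Q` is the set of qubits of one frame. A phase-free Pauli sequence on a stream of frames is a row
`[z(D) | x(D)]`: the coefficient of `D ^ t` in the entry `Sum.inl q` (resp. `Sum.inr q`) is the
exponent of the Pauli matrix `Z` (resp. `X`) on qubit `q` of frame `t`. Finite-weight sequences have
Laurent polynomial entries; the infinite-weight sequences that arise from infinite-depth operations
have rational entries. Products of Pauli sequences are sums of rows, and delaying a sequence by `l`
frames multiplies its row by `D ^ l`. -/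

/-- A (possibly infinite-weight) phase-free Pauli sequence. -/
abbrev PauliRow (Q : Type) : Type := Q ⊕ Q → BRat

/-- The shifted symplectic product `z(D)·x'(D⁻¹) + x(D)·z'(D⁻¹)` of two finite-weight Pauli
sequences. The coefficient of `D ^ t` is nonzero exactly when the first sequence anticommutes with
the second one delayed by `t` frames. -/
def shiftedSymp {Q : Type} [Fintype Q] (u v : Q ⊕ Q → BLaurent) : BLaurent :=
  ∑ q, (u (Sum.inl q) * LaurentPolynomial.invert (v (Sum.inr q)) +
    u (Sum.inr q) * LaurentPolynomial.invert (v (Sum.inl q)))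

/-- The Pauli matrix `Z` on qubit `q` of frame `0`. -/
def pauliZ {Q : Type} [DecidableEq Q] (q : Q) : PauliRow Q := Pi.single (Sum.inl q) 1

/-- The Pauli matrix `X` on qubit `q` of frame `0`. -/
def pauliX {Q : Type} [DecidableEq Q] (q : Q) : PauliRow Q := Pi.single (Sum.inr q) 1

/-! ### Shift-invariant Clifford operations -/

/-- Shift-invariant Clifford operations on a stream of frames with qubits `Q`; each of them is
repeated in every frame. -/
inductive Gate (Q : Type) : Type
  /-- CNOT from qubit `i` to qubit `j` in a frame delayed by `k`. -/
  | cnot (i j : Q) (k : ℤ) (h : i ≠ j)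
  /-- Hadamard gate on qubit `i`. -/
  | hadamard (i : Q)
  /-- Phase gate on qubit `i`. -/
  | phase (i : Q)
  /-- Controlled-phase gate from qubit `i` to qubit `j` in a frame delayed by `k`. -/
  | cphase (i j : Q) (k : ℤ) (h : i ≠ j)
  /-- Controlled-phase gate from qubit `i` to qubit `i` in a frame delayed by `k`. -/
  | cphaseSelf (i : Q) (k : ℤ) (h : k ≠ 0)
  /-- Delay (or advance) the processing of qubit `i` by `l` frames. -/
  | delay (i : Q) (l : ℤ)
  /-- The infinite-depth operation `1 / f(D)` on qubit `i`, where `f(0) = 1`: for `t` running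
  upwards through the frames, a CNOT from qubit `i` of frame `t - l` to qubit `i` of frame `t` for
  every `l ≥ 1` such that `D ^ l` occurs in `f`. Each step touches only the present frame and the
  `deg f` frames before it, so that the operation is performed online. -/
  | infiniteDepth (i : Q) (f : (ZMod 2)[X]) (h : f.coeff 0 = 1)

namespace Gate

variable {Q : Type}

/-- The qubits of a frame on which an operation acts. -/
def qubits : Gate Q → Set Q
  | cnot i j _ _ => {i, j}
  | hadamard i => {i}
  | phase i => {i}
  | cphase i j _ _ => {i, j}
  | cphaseSelf i _ _ => {i}
  | delay i _ => {i}
  | infiniteDepth i _ _ => {i}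

/-- The finite-depth operations are all but the operations `1 / f(D)`. -/
def FiniteDepth : Gate Q → Prop
  | infiniteDepth _ _ _ => False
  | _ => True

/-- The action of an operation on Pauli sequences by conjugation, up to phases. -/
def act [DecidableEq Q] (g : Gate Q) (u : PauliRow Q) : PauliRow Q :=
  match g with
  | cnot i j k _ =>
      u + Pi.single (Sum.inr j) (delayPow k * u (Sum.inr i))
        + Pi.single (Sum.inl i) (delayPow (-k) * u (Sum.inl j))
  | hadamard i =>
      Function.update (Function.update u (Sum.inl i) (u (Sum.inr i))) (Sum.inr i) (u (Sum.inl i))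
  | phase i => u + Pi.single (Sum.inl i) (u (Sum.inr i))
  | cphase i j k _ =>
      u + Pi.single (Sum.inl j) (delayPow k * u (Sum.inr i))
        + Pi.single (Sum.inl i) (delayPow (-k) * u (Sum.inr j))
  | cphaseSelf i k _ =>
      u + Pi.single (Sum.inl i) ((delayPow k + delayPow (-k)) * u (Sum.inr i))
  | delay i l =>
      Function.update (Function.update u (Sum.inl i) (delayPow l * u (Sum.inl i)))
        (Sum.inr i) (delayPow l * u (Sum.inr i))
  | infiniteDepth i f _ =>
      Function.update
        (Function.update u (Sum.inl i)
          (toRat (LaurentPolynomial.invert (Polynomial.toLaurent f)) * u (Sum.inl i)))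
        (Sum.inr i) (u (Sum.inr i) / toRat (Polynomial.toLaurent f))

end Gate

/-- A circuit is a finite sequence of shift-invariant operations; the head acts first. -/
abbrev Circuit (Q : Type) : Type := List (Gate Q)

/-- The action of a circuit on Pauli sequences. -/
def Circuit.act {Q : Type} [DecidableEq Q] (C : Circuit Q) (u : PauliRow Q) : PauliRow Q :=
  C.foldl (fun v g => g.act v) u

/-- A circuit that consists of finite-depth operations only. -/
def Circuit.FiniteDepth {Q : Type} (C : Circuit Q) : Prop := ∀ g ∈ C, g.FiniteDepth

/-! ### Entanglement-assisted quantum convolutional codes -/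

/-- The qubits of one frame: the receiver's halves of the `c` ebits (`Sum.inl`) and the sender's
`n` qubits (`Sum.inr`). -/
abbrev FrameQubits (n c : ℕ) : Type := Fin c ⊕ Fin n

/-- How the sender's `n` qubits per frame are made up before encoding: `c` halves of ebits,
`n - k - c` ancilla qubits and `k` information qubits. -/
abbrev Layout (n k c : ℕ) : Type := Fin c ⊕ (Fin (n - k - c) ⊕ Fin k) ≃ Fin n

/-- Labels of the stabilizer generators: two for each ebit and one for each ancilla qubit. -/
abbrev StabIndex (n k c : ℕ) : Type := (Fin c ⊕ Fin c) ⊕ Fin (n - k - c)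

/-- Generators of the stabilizer of the unencoded stream: `Z ⊗ Z` and `X ⊗ X` on every ebit, and
`Z` on every ancilla qubit. -/
def initialStabilizer {n k c : ℕ} (e : Layout n k c) :
    StabIndex n k c → PauliRow (FrameQubits n c)
  | Sum.inl (Sum.inl i) => pauliZ (Sum.inl i) + pauliZ (Sum.inr (e (Sum.inl i)))
  | Sum.inl (Sum.inr i) => pauliX (Sum.inl i) + pauliX (Sum.inr (e (Sum.inl i)))
  | Sum.inr i => pauliZ (Sum.inr (e (Sum.inr (Sum.inl i))))

/-- The sender's qubit that holds the `i`-th information qubit of a frame before encoding. -/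
def infoQubit {n k c : ℕ} (e : Layout n k c) (i : Fin k) : FrameQubits n c :=
  Sum.inr (e (Sum.inr (Sum.inr i)))

/-- `u` and `v` differ by a (finite) product of delayed members of the family `S`. -/
def EqModStabilizer {Q σ : Type} [Fintype σ] (S : σ → PauliRow Q) (u v : PauliRow Q) : Prop :=
  ∃ m : σ → BLaurent, u = v + ∑ s, toRat (m s) • S s

/-- An `[[n, k; c]]` entanglement-assisted quantum convolutional code: per frame, the sender encodes
`k` information qubits with the help of `c` ebits and `n - k - c` ancilla qubits by an online
shift-invariant Clifford circuit that acts on her own qubits only; a finite-depth circuit of the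
receiver, who then holds all the qubits, restores the information qubits. -/
structure Code (n k c : ℕ) where
  /-- The composition of the sender's frame. -/
  layout : Layout n k c
  /-- The sender's encoding circuit. -/
  encoder : Circuit (FrameQubits n c)
  /-- The encoding circuit does not act on the receiver's halves of the ebits. -/
  encoder_local : ∀ g ∈ encoder, g.qubits ⊆ Set.range Sum.inr
  /-- The receiver's decoding circuit. -/
  decoder : Circuit (FrameQubits n c)
  /-- The decoding circuit has finite-depth operations only. -/
  decoder_finiteDepth : decoder.FiniteDepth
  /-- The qubits that hold the information qubits after decoding. -/
  output : Fin k ↪ FrameQubits n c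
  /-- Encoding and decoding takes the operator `Z` of each information qubit to the operator `Z` of
  its output qubit, up to the stabilizer of the decoded stream. -/
  decodes_Z : ∀ i, EqModStabilizer
    (fun s => decoder.act (encoder.act (initialStabilizer layout s)))
    (decoder.act (encoder.act (pauliZ (infoQubit layout i)))) (pauliZ (output i))
  /-- The same for the operators `X`. -/
  decodes_X : ∀ i, EqModStabilizer
    (fun s => decoder.act (encoder.act (initialStabilizer layout s)))
    (decoder.act (encoder.act (pauliX (infoQubit layout i)))) (pauliX (output i))

/-- Generators of the stabilizer of the encoded stream. -/
def Code.stabilizer {n k c : ℕ} (C : Code n k c) :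
    StabIndex n k c → PauliRow (FrameQubits n c) :=
  fun s => C.encoder.act (initialStabilizer C.layout s)

/-- The sender's part `[z(D) | x(D)]` of a Pauli sequence. -/
def senderPart {n c : ℕ} (u : FrameQubits n c ⊕ FrameQubits n c → BLaurent) :
    Fin n ⊕ Fin n → BLaurent :=
  Sum.elim (fun q => u (Sum.inl (Sum.inr q))) (fun q => u (Sum.inr (Sum.inr q)))

/-- The code `C` realizes the quantum check matrix `H(D)` on the sender's qubits: there are
finite-weight Pauli sequences `G`, the rows of `H(D)` extended to the receiver's halves of the
ebits, that commute with each other and with all their shifts and that arise from the stabilizer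
generators of the encoded stream by row operations, i.e. by a matrix `R(D)` that is invertible over
the rational functions. -/
def Code.Realizes {n k c : ℕ} (C : Code n k c) {ι : Type} [Fintype ι] [DecidableEq ι]
    (H : Matrix ι (Fin n ⊕ Fin n) BLaurent) : Prop :=
  ∃ (G : ι → FrameQubits n c ⊕ FrameQubits n c → BLaurent)
    (R : Matrix ι (StabIndex n k c) BLaurent) (R' : Matrix (StabIndex n k c) ι BRat),
    (∀ i, senderPart (G i) = H i) ∧
    (∀ i j, shiftedSymp (G i) (G j) = 0) ∧
    R.map toRat * R' = 1 ∧ R' * R.map toRat = 1 ∧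
    ∀ i, (fun q => toRat (G i q)) = ∑ s, toRat (R i s) • C.stabilizer s

/-- The quantum check matrix `[H₁(D) 0 | 0 H₂(D)]` in CSS form: the first rows are `Z`-type with
`H₁(D)`, the other rows are `X`-type with `H₂(D)`. -/
def cssCheckMatrix {r₁ r₂ n : ℕ} (H₁ : Matrix (Fin r₁) (Fin n) (ZMod 2)[X])
    (H₂ : Matrix (Fin r₂) (Fin n) (ZMod 2)[X]) :
    Matrix (Fin r₁ ⊕ Fin r₂) (Fin n ⊕ Fin n) BLaurent :=
  Matrix.fromBlocks (toLaurentMatrix H₁) 0 0 (toLaurentMatrix H₂)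

end EAQC

end

/-!
A noncatastrophic check matrix has a right inverse over the Laurent polynomials. These form a
principal ideal domain, so row operations on `H₁` and `H₂` bring `H₁(D) H₂ᵀ(D⁻¹)` into the shape
`diag(γ, 0)` with `γ` of length `c`. The rows of the new `H₂`, together with rows dual to the part
of `H₁` that is orthogonal to `H₂`, extend to a basis of the sender's row space. In the dual basis,
the remaining rows of `H₁` are `γ` times the rows dual to the `c` rows of `H₂` that they overlap,
plus combinations of the rows dual to the information qubits. Invertible Laurent matrices are
products of elementary and delay matrices, hence finite-depth CNOT circuits; only the scalings by
`γ` may need infinite depth, and they are delays when `γ` is monomial. The decoder inverts the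
change of basis and uses the receiver's halves of the ebits to cancel the coupling of the ebits with
the information qubits.
-/

namespace EAQC

open scoped Matrix

/-! ### Elementary matrices and diagonalization -/

section Elementary

variable {R : Type*} [CommRing R] {m n : Type*} [Fintype m] [DecidableEq m] [Fintype n]
  [DecidableEq n]

/-- The products of transvections. They form a group, but are kept as matrices. -/
def elementary (n R : Type*) [Fintype n] [DecidableEq n] [CommRing R] : Submonoid (Matrix n n R) :=
  Submonoid.closure (Set.range Matrix.TransvectionStruct.toMatrix)

theorem transvection_mem_elementary {i j : n} (hij : i ≠ j) (a : R) :
    Matrix.transvection i j a ∈ elementary n R :=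
  Submonoid.subset_closure ⟨⟨i, j, hij, a⟩, rfl⟩

theorem exists_inverse_mem_elementary {A : Matrix n n R} (hA : A ∈ elementary n R) :
    ∃ A' ∈ elementary n R, A * A' = 1 ∧ A' * A = 1 := by
  induction hA using Submonoid.closure_induction with
  | mem A hA =>
    obtain ⟨t, rfl⟩ := hA
    exact ⟨t.inv.toMatrix, Submonoid.subset_closure ⟨_, rfl⟩, t.mul_inv, t.inv_mul⟩
  | one => exact ⟨1, one_mem _, mul_one 1, mul_one 1⟩
  | mul A B _ _ hA hB =>
    obtain ⟨A', hA', hAA', hA'A⟩ := hA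
    obtain ⟨B', hB', hBB', hB'B⟩ := hB
    refine ⟨B' * A', mul_mem hB' hA', ?_, ?_⟩
    · rw [mul_assoc, ← mul_assoc B, hBB', one_mul, hAA']
    · rw [mul_assoc, ← mul_assoc A', hA'A, one_mul, hB'B]

theorem isUnit_of_mem_elementary {A : Matrix n n R} (hA : A ∈ elementary n R) : IsUnit A := by
  obtain ⟨A', -, hAA', hA'A⟩ := exists_inverse_mem_elementary hA
  exact ⟨⟨A, A', hAA', hA'A⟩, rfl⟩

theorem transpose_mem_elementary {A : Matrix n n R} (hA : A ∈ elementary n R) :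
    Aᵀ ∈ elementary n R := by
  induction hA using Submonoid.closure_induction with
  | mem A hA =>
    obtain ⟨⟨i, j, hij, a⟩, rfl⟩ := hA
    rw [Matrix.TransvectionStruct.toMatrix_mk, Matrix.transvection, Matrix.transpose_add,
      Matrix.transpose_one, Matrix.transpose_single]
    exact transvection_mem_elementary hij.symm a
  | one => rw [Matrix.transpose_one]; exact one_mem _
  | mul A B _ _ hA hB => rw [Matrix.transpose_mul]; exact mul_mem hB hA

theorem map_mem_elementary {S : Type*} [CommRing S] (f : R →+* S) {A : Matrix n n R}
    (hA : A ∈ elementary n R) : A.map f ∈ elementary n S := by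
  induction hA using Submonoid.closure_induction with
  | mem A hA =>
    obtain ⟨⟨i, j, hij, a⟩, rfl⟩ := hA
    rw [Matrix.TransvectionStruct.toMatrix_mk, Matrix.transvection,
      Matrix.map_add _ (map_add f), Matrix.map_one _ (map_zero f) (map_one f),
      Matrix.map_single _ _ _ f]
    exact transvection_mem_elementary hij (f a)
  | one => rw [Matrix.map_one _ (map_zero f) (map_one f)]; exact one_mem _
  | mul A B _ _ hA hB => rw [Matrix.map_mul]; exact mul_mem hA hB

theorem reindex_mem_elementary (e : n ≃ m) {A : Matrix n n R} (hA : A ∈ elementary n R) :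
    Matrix.reindex e e A ∈ elementary m R := by
  induction hA using Submonoid.closure_induction with
  | mem A hA =>
    obtain ⟨t, rfl⟩ := hA
    rw [← Matrix.coe_reindexAlgEquiv R R, ← Matrix.TransvectionStruct.toMatrix_reindexEquiv]
    exact Submonoid.subset_closure ⟨_, rfl⟩
  | one => rw [Matrix.reindex_apply, Matrix.submatrix_one_equiv]; exact one_mem _
  | mul A B _ _ hA hB =>
    rw [← Matrix.coe_reindexAlgEquiv R R, map_mul]
    exact mul_mem hA hB

theorem one_add_vecMulVec_single_mem_elementary {i : n} {q : n → R} (hq : q i = 0) :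
    1 + Matrix.vecMulVec q (Pi.single i 1) ∈ elementary n R := by
  suffices h : ∀ s : Finset n,
      1 + Matrix.vecMulVec (∑ j ∈ s, Pi.single j (q j)) (Pi.single i 1) ∈ elementary n R by
    simpa only [Finset.univ_sum_single] using h Finset.univ
  intro s
  induction s using Finset.induction_on with
  | empty => simp only [Finset.sum_empty, Matrix.zero_vecMulVec, add_zero, one_mem]
  | insert j s hj ih =>
    rw [Finset.sum_insert hj]
    obtain rfl | hji := eq_or_ne j i
    · rwa [hq, Pi.single_zero, zero_add]
    convert mul_mem ih (transvection_mem_elementary hji (q j)) using 1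
    have hsingle : Matrix.single j i (q j) =
        Matrix.vecMulVec (Pi.single j (q j)) (Pi.single i 1) := by
      ext k l
      simp [Matrix.single_apply, Matrix.vecMulVec_apply, Pi.single_apply, ← ite_and, eq_comm,
        and_comm]
    rw [Matrix.transvection, hsingle, mul_add, mul_one, add_mul, one_mul,
      Matrix.vecMulVec_mul_vecMulVec, Matrix.add_vecMulVec]
    simp only [single_one_dotProduct, Pi.single_eq_of_ne hji.symm, zero_smul, Matrix.vecMulVec_zero,
      add_zero]
    abel

variable (M N : Matrix m n R)

/-- `N` arises from `M` by adding multiples of rows to other rows and multiples of columns to other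
columns. -/
def ElementaryEquiv : Prop :=
  ∃ A ∈ elementary m R, ∃ B ∈ elementary n R, N = A * M * B

variable {M N} {P : Matrix m n R}

namespace ElementaryEquiv

theorem refl (M : Matrix m n R) : ElementaryEquiv M M :=
  ⟨1, one_mem _, 1, one_mem _, by rw [Matrix.one_mul, Matrix.mul_one]⟩

theorem trans (h : ElementaryEquiv M N) (h' : ElementaryEquiv N P) : ElementaryEquiv M P := by
  obtain ⟨A, hA, B, hB, rfl⟩ := h
  obtain ⟨A', hA', B', hB', rfl⟩ := h'
  exact ⟨A' * A, mul_mem hA' hA, B * B', mul_mem hB hB', by simp only [Matrix.mul_assoc]⟩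

theorem symm (h : ElementaryEquiv M N) : ElementaryEquiv N M := by
  obtain ⟨A, hA, B, hB, rfl⟩ := h
  obtain ⟨A', hA', -, hA'A⟩ := exists_inverse_mem_elementary hA
  obtain ⟨B', hB', hBB', -⟩ := exists_inverse_mem_elementary hB
  refine ⟨A', hA', B', hB', ?_⟩
  rw [Matrix.mul_assoc, Matrix.mul_assoc, hBB', Matrix.mul_one, ← Matrix.mul_assoc, hA'A,
    Matrix.one_mul]

theorem transpose (h : ElementaryEquiv M N) : ElementaryEquiv Mᵀ Nᵀ := by
  obtain ⟨A, hA, B, hB, rfl⟩ := h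
  exact ⟨Bᵀ, transpose_mem_elementary hB, Aᵀ, transpose_mem_elementary hA,
    by simp only [Matrix.transpose_mul, Matrix.mul_assoc]⟩

theorem add_vecMulVec_row (M : Matrix m n R) {i : m} {q : m → R} (hq : q i = 0) :
    ElementaryEquiv M (M + Matrix.vecMulVec q (M i)) := by
  refine ⟨_, one_add_vecMulVec_single_mem_elementary hq, 1, one_mem _, ?_⟩
  rw [Matrix.mul_one, Matrix.add_mul, Matrix.one_mul, Matrix.vecMulVec_mul,
    Matrix.single_one_vecMul, Matrix.row]

theorem updateRow (M : Matrix m n R) {i i' : m} (hi : i' ≠ i) (a : R) :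
    ElementaryEquiv M (M.updateRow i' (M i' + a • M i)) := by
  convert add_vecMulVec_row M (q := Pi.single i' a) (Pi.single_eq_of_ne hi.symm a)
  ext k l
  obtain rfl | hk := eq_or_ne k i' <;> simp [Matrix.vecMulVec_apply, *]

end ElementaryEquiv

/-- The block diagonal matrix with the `1 × 1` block `x` and the block `M`. -/
def bordered {m n : ℕ} (x : R) (M : Matrix (Fin m) (Fin n) R) :
    Matrix (Fin (m + 1)) (Fin (n + 1)) R :=
  Matrix.of (Fin.cons (Fin.cons x 0) fun i => Fin.cons 0 (M i))

theorem bordered_mul_bordered {l m n : ℕ} (x y : R) (M : Matrix (Fin l) (Fin m) R)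
    (N : Matrix (Fin m) (Fin n) R) : bordered x M * bordered y N = bordered (x * y) (M * N) := by
  ext i j
  cases i using Fin.cases <;> cases j using Fin.cases <;>
    simp [bordered, Matrix.mul_apply, Fin.sum_univ_succ]

theorem bordered_one_mem_elementary {n : ℕ} {A : Matrix (Fin n) (Fin n) R}
    (hA : A ∈ elementary (Fin n) R) : bordered 1 A ∈ elementary (Fin (n + 1)) R := by
  induction hA using Submonoid.closure_induction with
  | mem A hA =>
    obtain ⟨⟨i, j, hij, a⟩, rfl⟩ := hA
    convert transvection_mem_elementary (Fin.succ_injective _ |>.ne hij) a using 1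
    ext k l
    cases k using Fin.cases <;> cases l using Fin.cases <;>
      simp [bordered, Matrix.transvection, Matrix.single_apply, Matrix.one_apply,
        Fin.succ_ne_zero, (Fin.succ_ne_zero _).symm]
  | one =>
    convert one_mem (elementary (Fin (n + 1)) R)
    ext k l
    cases k using Fin.cases <;> cases l using Fin.cases <;>
      simp [bordered, Matrix.one_apply, Fin.succ_ne_zero, (Fin.succ_ne_zero _).symm]
  | mul A B _ _ hA hB => simpa only [bordered_mul_bordered, one_mul] using mul_mem hA hB

theorem ElementaryEquiv.bordered {m n : ℕ} (x : R) {M N : Matrix (Fin m) (Fin n) R}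
    (h : ElementaryEquiv M N) : ElementaryEquiv (bordered x M) (bordered x N) := by
  obtain ⟨A, hA, B, hB, rfl⟩ := h
  exact ⟨_, bordered_one_mem_elementary hA, _, bordered_one_mem_elementary hB,
    by simp only [bordered_mul_bordered, one_mul, mul_one]⟩

/-- The `m × n` matrix with the entries `d 0, …, d (s - 1)` at the beginning of its diagonal and
zeros elsewhere. -/
def partialDiagonal (m n s : ℕ) (d : ℕ → R) : Matrix (Fin m) (Fin n) R :=
  Matrix.of fun i j => if i.val = j.val ∧ i.val < s then d i.val else 0

theorem bordered_partialDiagonal (m n s : ℕ) (x : R) (d : ℕ → R) :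
    bordered x (partialDiagonal m n s d) =
      partialDiagonal (m + 1) (n + 1) (s + 1) fun i => Nat.casesOn i x d := by
  ext i j
  cases i using Fin.cases <;> cases j using Fin.cases <;> simp [bordered, partialDiagonal]

end Elementary

section Euclidean

variable {R : Type*} [EuclideanDomain R] {m n : Type*} [Fintype m] [DecidableEq m] [Fintype n]
  [DecidableEq n] {M N : Matrix m n R} {i : m} {j : n}

/-- A nonzero entry of `M` that is minimal, for the Euclidean order, among all the nonzero entries
of all the matrices that are elementarily equivalent to `M`. -/
def IsMinimalEntry (M : Matrix m n R) (i : m) (j : n) : Prop :=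
  M i j ≠ 0 ∧ ∀ N, ElementaryEquiv M N → ∀ i' j', N i' j' ≠ 0 →
    ¬ EuclideanDomain.r (N i' j') (M i j)

theorem exists_isMinimalEntry (hM : M ≠ 0) :
    ∃ N, ElementaryEquiv M N ∧ ∃ i j, IsMinimalEntry N i j := by
  let S : Set R := {x | x ≠ 0 ∧ ∃ N, ElementaryEquiv M N ∧ ∃ i j, N i j = x}
  have hS : S.Nonempty := by
    obtain ⟨i, j, hij⟩ : ∃ i j, M i j ≠ 0 := by
      contrapose! hM
      exact Matrix.ext hM
    exact ⟨M i j, hij, M, .refl M, i, j, rfl⟩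
  obtain ⟨x, ⟨hx, N, hMN, i, j, rfl⟩, hmin⟩ := EuclideanDomain.r_wellFounded.has_min S hS
  exact ⟨N, hMN, i, j, hx, fun P hNP i' j' hP => hmin _ ⟨hP, P, hMN.trans hNP, i', j', rfl⟩⟩

namespace IsMinimalEntry

theorem of_elementaryEquiv (h : IsMinimalEntry M i j) (hMN : ElementaryEquiv M N) {i' : m} {j' : n}
    (hN : N i' j' = M i j) : IsMinimalEntry N i' j' :=
  ⟨hN ▸ h.1, fun P hNP => hN ▸ h.2 P (hMN.trans hNP)⟩

theorem transpose (h : IsMinimalEntry M i j) : IsMinimalEntry Mᵀ j i :=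
  ⟨h.1, fun N hN i' j' => h.2 Nᵀ (M.transpose_transpose ▸ hN.transpose) j' i'⟩

theorem dvd_column (h : IsMinimalEntry M i j) (i' : m) : M i j ∣ M i' j := by
  obtain rfl | hi := eq_or_ne i' i
  · rfl
  rw [← EuclideanDomain.mod_eq_zero]
  by_contra hmod
  have hentry : M.updateRow i' (M i' + -(M i' j / M i j) • M i) i' j = M i' j % M i j := by
    rw [Matrix.updateRow_self, Pi.add_apply, Pi.smul_apply, smul_eq_mul,
      EuclideanDomain.mod_eq_sub_mul_div]
    ring
  refine h.2 _ (.updateRow M hi (-(M i' j / M i j))) i' j ?_ ?_ <;> rw [hentry]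
  exacts [hmod, EuclideanDomain.mod_lt _ h.1]

theorem exists_move_row (h : IsMinimalEntry M i j) (i' : m) :
    ∃ N, ElementaryEquiv M N ∧ IsMinimalEntry N i' j := by
  obtain rfl | hi := eq_or_ne i' i
  · exact ⟨M, .refl M, h⟩
  obtain ⟨q, hq⟩ := h.dvd_column i'
  have hMN := ElementaryEquiv.updateRow M hi (1 - q)
  refine ⟨_, hMN, h.of_elementaryEquiv hMN ?_⟩
  rw [Matrix.updateRow_self, Pi.add_apply, Pi.smul_apply, smul_eq_mul, hq]
  ring

theorem exists_move_column (h : IsMinimalEntry M i j) (j' : n) :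
    ∃ N, ElementaryEquiv M N ∧ IsMinimalEntry N i j' := by
  obtain ⟨N, hMN, hN⟩ := h.transpose.exists_move_row j'
  exact ⟨Nᵀ, hMN.transpose, hN.transpose⟩

theorem exists_clear_column (h : IsMinimalEntry M i j) :
    ∃ N, ElementaryEquiv M N ∧ N i = M i ∧ ∀ i' ≠ i, N i' j = 0 := by
  choose q hq using h.dvd_column
  have hMN := ElementaryEquiv.add_vecMulVec_row M (i := i)
    (q := fun i' => if i' = i then 0 else -q i') (if_pos rfl)
  refine ⟨_, hMN, ?_, fun i' hi => ?_⟩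
  · ext k
    simp [Matrix.vecMulVec_apply]
  · rw [Matrix.add_apply, Matrix.vecMulVec_apply, if_neg hi, hq i']
    ring

theorem exists_elementaryEquiv_bordered {m n : ℕ} {M : Matrix (Fin (m + 1)) (Fin (n + 1)) R}
    {i : Fin (m + 1)} {j : Fin (n + 1)} (h : IsMinimalEntry M i j) :
    ∃ x ≠ 0, ∃ N, ElementaryEquiv M (bordered x N) := by
  obtain ⟨M₁, hM₁, h₁⟩ := h.exists_move_row 0
  obtain ⟨M₂, hM₂, h₂⟩ := h₁.exists_move_column 0
  obtain ⟨M₃, hM₃, hrow₃, hcol₃⟩ := h₂.exists_clear_column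
  have h₃ : IsMinimalEntry M₃ 0 0 := h₂.of_elementaryEquiv hM₃ (congrFun hrow₃ 0)
  obtain ⟨M₄, hM₄, hrow₄, hcol₄⟩ := h₃.transpose.exists_clear_column
  refine ⟨M₃ 0 0, h₃.1, Matrix.of fun k l => M₄ l.succ k.succ, ?_⟩
  convert ((hM₁.trans hM₂).trans hM₃).trans hM₄.transpose using 1
  ext k l
  cases k using Fin.cases <;> cases l using Fin.cases <;>
    simp [bordered, hrow₄, hcol₃, hcol₄]

end IsMinimalEntry

theorem exists_elementaryEquiv_partialDiagonal : ∀ {m n : ℕ} (M : Matrix (Fin m) (Fin n) R),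
    ∃ s d, s ≤ m ∧ s ≤ n ∧ (∀ i < s, d i ≠ 0) ∧ ElementaryEquiv M (partialDiagonal m n s d)
  | m + 1, n + 1, M => by
    by_cases hM : M = 0
    · refine ⟨0, 0, by simp, by simp, by simp, ?_⟩
      convert ElementaryEquiv.refl M
      ext i j
      simp [hM, partialDiagonal]
    · obtain ⟨M', hM', i, j, hmin⟩ := exists_isMinimalEntry hM
      obtain ⟨x, hx, N, hN⟩ := hmin.exists_elementaryEquiv_bordered
      obtain ⟨s, d, hsm, hsn, hd, h⟩ := exists_elementaryEquiv_partialDiagonal N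
      refine ⟨s + 1, fun i => Nat.casesOn i x d, by lia, by lia, ?_, ?_⟩
      · rintro (_ | i) hi
        exacts [hx, hd i (by lia)]
      · rw [← bordered_partialDiagonal]
        exact (hM'.trans hN).trans (h.bordered x)
  | 0, n, M => ⟨0, 0, by simp, by simp, by simp,
      by convert ElementaryEquiv.refl M; ext i; exact i.elim0⟩
  | m + 1, 0, M => ⟨0, 0, by simp, by simp, by simp,
      by convert ElementaryEquiv.refl M; ext i j; exact j.elim0⟩

end Euclidean

/-! ### Smith forms of matrices of Laurent polynomials -/

section Laurent

open LaurentPolynomial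

variable {K : Type*} [Field K]

instance : IsPrincipalIdealRing K[T;T⁻¹] where
  principal I := by
    rw [← IsLocalization.map_under (Submonoid.powers (Polynomial.X : K[X])) K[T;T⁻¹] I]
    exact (IsPrincipalIdealRing.principal (I.under K[X])).map_ringHom _

theorem exists_eq_T_mul_toLaurent {f : K[T;T⁻¹]} (hf : f ≠ 0) :
    ∃ (l : ℤ) (g : K[X]), f = T l * Polynomial.toLaurent g ∧ g.coeff 0 ≠ 0 := by
  obtain ⟨m, p, hp⟩ := exists_T_pow f
  have hp0 : p ≠ 0 := by
    rintro rfl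
    rw [map_zero] at hp
    exact hf ((mul_eq_zero.mp hp.symm).resolve_right (isUnit_T _).ne_zero)
  obtain ⟨g, hg, hXg⟩ := Polynomial.exists_eq_pow_rootMultiplicity_mul_and_not_dvd p hp0 0
  rw [map_zero, sub_zero] at hg hXg
  refine ⟨p.rootMultiplicity 0 - m, g, ?_, mt Polynomial.X_dvd_iff.mpr hXg⟩
  rw [sub_eq_neg_add, T_add, mul_assoc, ← Polynomial.toLaurent_X_pow, ← map_mul, ← hg, hp,
    mul_comm f, ← mul_assoc, ← T_add, neg_add_cancel, T_zero, one_mul]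

theorem exists_toLaurent_eq_T_mul {ι : Type*} [Finite ι] (f : ι → K[T;T⁻¹]) :
    ∃ (k : ℕ) (g : ι → K[X]), ∀ i, Polynomial.toLaurent (g i) = T k * f i := by
  obtain ⟨⟨-, k, rfl⟩, h⟩ := IsLocalization.exist_integer_multiples_of_finite
    (Submonoid.powers (Polynomial.X : K[X])) f
  choose g hg using h
  exact ⟨k, g, fun i => by rw [← algebraMap_eq_toLaurent, hg, Algebra.smul_def, algebraMap_X_pow]⟩

theorem dvd_of_toLaurent_dvd {g p : K[X]} (hg : g.coeff 0 ≠ 0)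
    (h : Polynomial.toLaurent g ∣ Polynomial.toLaurent p) : g ∣ p := by
  obtain ⟨q, hq⟩ := h
  obtain ⟨k, q', hq'⟩ := exists_T_pow q
  have hcoprime : IsCoprime g (Polynomial.X ^ k) :=
    (Polynomial.prime_X.irreducible.coprime_iff_not_dvd.mpr
      (mt Polynomial.X_dvd_iff.mp hg)).pow_left.symm
  refine hcoprime.dvd_of_dvd_mul_right ⟨q', Polynomial.toLaurent_injective ?_⟩
  rw [map_mul, map_mul, hq, hq', Polynomial.toLaurent_X_pow, mul_assoc]

theorem isUnit_of_isUnit_toLaurent {g : K[X]} (hg : g.coeff 0 ≠ 0)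
    (h : IsUnit (Polynomial.toLaurent g)) : IsUnit g :=
  isUnit_of_dvd_one (dvd_of_toLaurent_dvd hg (h.dvd))

theorem exists_eq_C_mul_T_of_isUnit {f : K[T;T⁻¹]} (hf : IsUnit f) :
    ∃ (a : K) (l : ℤ), a ≠ 0 ∧ f = C a * T l := by
  obtain ⟨l, g, rfl, hg⟩ := exists_eq_T_mul_toLaurent hf.ne_zero
  obtain ⟨a, ha, rfl⟩ := Polynomial.isUnit_iff.mp
    (isUnit_of_isUnit_toLaurent hg (isUnit_of_mul_isUnit_right hf))
  exact ⟨a, l, ha.ne_zero, by rw [Polynomial.toLaurent_C, mul_comm]⟩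

variable (K) in
theorem not_isField_laurentPolynomial : ¬ IsField K[T;T⁻¹] := by
  intro h
  have hcoeff : (Polynomial.X + Polynomial.C 1 : K[X]).coeff 0 ≠ 0 := by simp
  have hne : Polynomial.toLaurent (Polynomial.X + Polynomial.C 1 : K[X]) ≠ 0 :=
    Polynomial.toLaurent_ne_zero.mpr (Polynomial.X_add_C_ne_zero 1)
  obtain ⟨f, hf⟩ := h.mul_inv_cancel hne
  exact Polynomial.not_isUnit_X_add_C 1
    (isUnit_of_isUnit_toLaurent hcoeff (IsUnit.of_mul_eq_one f hf))

theorem exists_eq_mul_partialDiagonal_mul {m n : ℕ} (M : Matrix (Fin m) (Fin n) K[T;T⁻¹]) :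
    ∃ A ∈ elementary (Fin m) K[T;T⁻¹], ∃ B ∈ elementary (Fin n) K[T;T⁻¹],
      ∃ (s : ℕ) (d : ℕ → K[T;T⁻¹]), s ≤ m ∧ s ≤ n ∧ (∀ i < s, d i ≠ 0) ∧
        M = A * partialDiagonal m n s d * B := by
  classical
  obtain ⟨k, g, hg⟩ := exists_toLaurent_eq_T_mul fun ij : Fin m × Fin n => M ij.1 ij.2
  let M' : Matrix (Fin m) (Fin n) K[X] := Matrix.of fun i j => g (i, j)
  have hM' : M'.map Polynomial.toLaurent = (T k : K[T;T⁻¹]) • M :=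
    Matrix.ext fun i j => hg (i, j)
  obtain ⟨s, d, hsm, hsn, hd, hequiv⟩ := exists_elementaryEquiv_partialDiagonal M'
  obtain ⟨A, hA, B, hB, hAB⟩ := hequiv.symm
  refine ⟨_, map_mem_elementary Polynomial.toLaurent hA, _,
    map_mem_elementary Polynomial.toLaurent hB, s,
    fun i => T (-k) * Polynomial.toLaurent (d i), hsm, hsn, fun i hi =>
      mul_ne_zero (isUnit_T _).ne_zero (Polynomial.toLaurent_ne_zero.mpr (hd i hi)), ?_⟩
  have hdiag : partialDiagonal m n s (fun i => T (-k) * Polynomial.toLaurent (d i)) =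
      (T (-k) : K[T;T⁻¹]) • (partialDiagonal m n s d).map Polynomial.toLaurent := by
    ext1 i j
    simp [partialDiagonal, apply_ite Polynomial.toLaurent]
  rw [hdiag, Matrix.mul_smul, Matrix.smul_mul, ← Matrix.map_mul, ← Matrix.map_mul, ← hAB, hM',
    smul_smul, ← T_add, neg_add_cancel, T_zero, one_smul]

theorem exists_eq_mul_diagonal_mul {n : Type*} [Fintype n] [DecidableEq n]
    (M : Matrix n n K[T;T⁻¹]) : ∃ A ∈ elementary n K[T;T⁻¹], ∃ B ∈ elementary n K[T;T⁻¹],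
      ∃ d : n → K[T;T⁻¹], M = A * Matrix.diagonal d * B := by
  let e := Fintype.equivFin n
  obtain ⟨A, hA, B, hB, s, d, -, -, -, h⟩ :=
    exists_eq_mul_partialDiagonal_mul (Matrix.reindex e e M)
  refine ⟨_, reindex_mem_elementary e.symm hA, _, reindex_mem_elementary e.symm hB,
    fun i => if (e i).val < s then d (e i) else 0, ?_⟩
  have hdiag : partialDiagonal _ _ s d = Matrix.reindex e e
      (Matrix.diagonal fun i => if (e i).val < s then d (e i) else 0) := by
    ext1 i j
    obtain rfl | hij := eq_or_ne i j
    · simp [partialDiagonal]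
    · simp [partialDiagonal, hij, Fin.val_ne_of_ne hij]
  rw [hdiag, ← Matrix.coe_reindexAlgEquiv K] at h
  apply (Matrix.reindexAlgEquiv K K[T;T⁻¹] e).injective
  rw [h]
  simp only [map_mul, Matrix.coe_reindexAlgEquiv]
  simp

theorem exists_eq_mul_diagonal_T_mul_of_isUnit {n : Type*} [Fintype n] [DecidableEq n]
    {M : Matrix n n BLaurent} (hM : IsUnit M) : ∃ A ∈ elementary n BLaurent,
      ∃ B ∈ elementary n BLaurent, ∃ l : n → ℤ, M = A * Matrix.diagonal (fun i => T (l i)) * B := by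
  obtain ⟨A, hA, B, hB, d, rfl⟩ := exists_eq_mul_diagonal_mul M
  have hd : IsUnit (Matrix.diagonal d) := by
    rwa [(isUnit_of_mem_elementary hB).mul_right_iff,
      (isUnit_of_mem_elementary hA).mul_left_iff] at hM
  have hmono : ∀ i, ∃ l, d i = T l := fun i => by
    obtain ⟨a, l, ha, h⟩ :=
      exists_eq_C_mul_T_of_isUnit (Pi.isUnit_iff.mp (Matrix.isUnit_diagonal.mp hd) i)
    have ha1 : a = 1 := Fin.eq_one_of_ne_zero a ha
    exact ⟨l, by rw [h, ha1, map_one, one_mul]⟩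
  choose l hl using hmono
  exact ⟨A, hA, B, hB, l, by simp only [← hl]⟩

end Laurent

section SmithForm

variable {R : Type*} [CommRing R] {m n ι : Type*} [Fintype m] [DecidableEq m] [Fintype n]
  [DecidableEq n] [Fintype ι] [DecidableEq ι]

/-- The matrix `diag(γ, 0)`, whose block of zeros has its rows indexed by `α` and its columns by
`β`. -/
abbrev paddedDiagonal (α β : Type*) (γ : ι → R) : Matrix (ι ⊕ α) (ι ⊕ β) R :=
  Matrix.fromBlocks (Matrix.diagonal γ) 0 0 0

theorem rank_paddedDiagonal {α β F : Type*} [Finite α] [Fintype β] [Field F] {γ : ι → F}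
    (hγ : ∀ i, γ i ≠ 0) :
    (paddedDiagonal α β γ).rank = Fintype.card ι := by
  cases nonempty_fintype α
  apply le_antisymm
  · have h : paddedDiagonal α β γ =
        Matrix.fromRows (Matrix.diagonal γ) (0 : Matrix α ι F) *
          Matrix.fromCols 1 (0 : Matrix ι β F) := by
      rw [Matrix.fromRows_mul_fromCols]
      simp only [Matrix.mul_one, Matrix.mul_zero]
    rw [h]
    exact (Matrix.rank_mul_le_left _ _).trans (Matrix.rank_le_card_width _)
  · have h : Matrix.diagonal γ = (Matrix.fromCols 1 0 : Matrix ι (ι ⊕ α) F) *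
        (paddedDiagonal α β γ * (Matrix.fromRows 1 0 : Matrix (ι ⊕ β) ι F)) := by
      simp [Matrix.fromBlocks_mul_fromRows, Matrix.fromCols_mul_fromRows]
    have hdet : IsUnit (Matrix.diagonal γ) :=
      Matrix.isUnit_diagonal.mpr (Pi.isUnit_iff.mpr fun i => (hγ i).isUnit)
    calc Fintype.card ι = (Matrix.diagonal γ).rank := (Matrix.rank_of_isUnit _ hdet).symm
      _ ≤ _ := by
        rw [h]
        exact (Matrix.rank_mul_le_right _ _).trans (Matrix.rank_mul_le_left _ _)

/-- `P` is equivalent, over `R`, to `diag(γ, 0)`. The two equivalences are given together with their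
inverses, since the row (and column) indices on both sides need not be the same type. -/
def HasSmithForm (P : Matrix m n R) (α β : Type*) [Fintype α] [DecidableEq α] [Fintype β]
    [DecidableEq β] (γ : ι → R) : Prop :=
  ∃ (A : Matrix m (ι ⊕ α) R) (A' : Matrix (ι ⊕ α) m R) (B : Matrix (ι ⊕ β) n R)
    (B' : Matrix n (ι ⊕ β) R), A * A' = 1 ∧ A' * A = 1 ∧ B * B' = 1 ∧ B' * B = 1 ∧
    P = A * paddedDiagonal α β γ * B

variable {α β : Type*} [Fintype α] [DecidableEq α] [Fintype β] [DecidableEq β]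

theorem HasSmithForm.card_eq [Nontrivial R] {P : Matrix m n R} {γ : ι → R}
    (hP : HasSmithForm P α β γ) :
    Fintype.card m = Fintype.card ι + Fintype.card α ∧
      Fintype.card n = Fintype.card ι + Fintype.card β := by
  obtain ⟨A, A', B, B', hAA', hA'A, hBB', hB'B, -⟩ := hP
  rw [← Fintype.card_sum, ← Fintype.card_sum]
  exact ⟨Matrix.square_of_invertible A A' hAA' hA'A, Matrix.square_of_invertible B' B hB'B hBB'⟩

theorem hasSmithForm_mul_partialDiagonal_mul {s a b : ℕ} {A : Matrix (Fin (s + a)) (Fin (s + a)) R}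
    {B : Matrix (Fin (s + b)) (Fin (s + b)) R} (hA : IsUnit A) (hB : IsUnit B) (d : ℕ → R) :
    HasSmithForm (A * partialDiagonal (s + a) (s + b) s d * B) (Fin a) (Fin b)
      fun i : Fin s => d i := by
  obtain ⟨A', hAA', hA'A⟩ := isUnit_iff_exists.mp hA
  obtain ⟨B', hBB', hB'B⟩ := isUnit_iff_exists.mp hB
  have hne : ∀ (i : Fin s) (j : Fin b), i.val ≠ s + j.val := fun i j => by lia
  have hdiag : paddedDiagonal (Fin a) (Fin b) (fun i : Fin s => d i) =
      (partialDiagonal (s + a) (s + b) s d).submatrix finSumFinEquiv finSumFinEquiv := by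
    ext (i | i) (j | j) <;> simp [partialDiagonal, Matrix.diagonal_apply, Fin.ext_iff, hne]
  refine ⟨A.submatrix id finSumFinEquiv, A'.submatrix finSumFinEquiv id,
    B.submatrix finSumFinEquiv id, B'.submatrix id finSumFinEquiv, ?_⟩
  simp only [hdiag, Matrix.submatrix_mul_equiv, hAA', hA'A, hBB', hB'B, Matrix.submatrix_one_equiv,
    Matrix.submatrix_id_id, true_and, ← Matrix.submatrix_mul _ _ _ _ _ Function.bijective_id]

theorem toRat_injective : Function.Injective toRat := IsFractionRing.injective BLaurent BRat

theorem ratRank_eq_card_of_hasSmithForm {r₁ r₂ : ℕ} {P : Matrix (Fin r₁) (Fin r₂) BLaurent}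
    {γ : ι → BLaurent} (hP : HasSmithForm P α β γ) (hγ : ∀ i, γ i ≠ 0) :
    ratRank P = Fintype.card ι := by
  obtain ⟨A, A', B, B', -, hA'A, hBB', -, rfl⟩ := hP
  have hdiag : (paddedDiagonal α β γ).map toRat = paddedDiagonal α β fun i => toRat (γ i) := by
    simp only [Matrix.fromBlocks_map, Matrix.diagonal_map (map_zero toRat),
      Matrix.map_zero toRat (map_zero toRat)]
  rw [ratRank, ← rank_paddedDiagonal (α := α) (β := β) fun i =>
    (map_ne_zero_iff toRat toRat_injective).mpr (hγ i), ← hdiag]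
  apply le_antisymm
  · rw [Matrix.map_mul, Matrix.map_mul]
    exact (Matrix.rank_mul_le_left _ _).trans (Matrix.rank_mul_le_right _ _)
  · have hback : paddedDiagonal α β γ = A' * (A * paddedDiagonal α β γ * B) * B' := by
      rw [Matrix.mul_assoc, Matrix.mul_assoc, hBB', Matrix.mul_one, ← Matrix.mul_assoc, hA'A,
        Matrix.one_mul]
    nth_rewrite 1 [hback]
    rw [Matrix.map_mul, Matrix.map_mul]
    exact (Matrix.rank_mul_le_left _ _).trans (Matrix.rank_mul_le_right _ _)

theorem exists_hasSmithForm {r₁ r₂ : ℕ} (P : Matrix (Fin r₁) (Fin r₂) BLaurent) :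
    ∃ (s a b : ℕ) (γ : Fin s → BLaurent), (∀ i, γ i ≠ 0) ∧ HasSmithForm P (Fin a) (Fin b) γ := by
  obtain ⟨A, hA, B, hB, s, d, hs₁, hs₂, hd, rfl⟩ := exists_eq_mul_partialDiagonal_mul P
  obtain ⟨a, rfl⟩ := Nat.exists_eq_add_of_le hs₁
  obtain ⟨b, rfl⟩ := Nat.exists_eq_add_of_le hs₂
  exact ⟨s, a, b, fun i => d i, fun i => hd i i.isLt, hasSmithForm_mul_partialDiagonal_mul
    (isUnit_of_mem_elementary hA) (isUnit_of_mem_elementary hB) d⟩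

theorem HasMonomialSmithForm.exists_hasSmithForm {s a b : ℕ}
    {P : Matrix (Fin (s + a)) (Fin (s + b)) BLaurent} (hP : HasMonomialSmithForm P s) :
    ∃ l : Fin s → ℤ, HasSmithForm P (Fin a) (Fin b) fun i => LaurentPolynomial.T (l i) := by
  obtain ⟨A, B, l, hA, hB, rfl⟩ := hP
  exact ⟨fun i => l i,
    hasSmithForm_mul_partialDiagonal_mul hA hB fun i => LaurentPolynomial.T (l i)⟩

end SmithForm

/-! ### Noncatastrophic matrices -/

section Noncatastrophic

theorem exists_isMaximal_of_not_surjective_mulVec {R m n : Type*} [CommRing R] [Fintype m]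
    [Fintype n] {M : Matrix m n R} (hM : ¬ Function.Surjective M.mulVec) :
    ∃ I : Ideal R, I.IsMaximal ∧ ∃ v : m → R, (∃ i, v i ∉ I) ∧ ∀ j, (v ᵥ* M) j ∈ I := by
  classical
  have hrange : LinearMap.range M.mulVecLin ≠ ⊤ := fun h =>
    hM (LinearMap.range_eq_top.mp h)
  obtain ⟨N, hN, hMN⟩ := (eq_top_or_exists_le_coatom _).resolve_left hrange
  have : IsSimpleModule R ((m → R) ⧸ N) := isSimpleModule_iff_isCoatom.mpr hN
  obtain ⟨I, hI, ⟨φ⟩⟩ := isSimpleModule_iff_quot_maximal.mp this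
  let π : (m → R) →ₗ[R] R ⧸ I := φ.toLinearMap ∘ₗ N.mkQ
  choose v hv using fun i => Ideal.Quotient.mk_surjective (π (Pi.single i 1))
  have hπ : ∀ x, π x = Ideal.Quotient.mk I (x ⬝ᵥ v) := fun x => by
    conv_lhs => rw [← (Pi.basisFun R m).sum_repr x]
    rw [map_sum, dotProduct, map_sum]
    refine Finset.sum_congr rfl fun i _ => ?_
    rw [map_smul, Pi.basisFun_apply, Pi.basisFun_repr, ← hv, Algebra.smul_def, map_mul,
      Ideal.Quotient.algebraMap_eq]
  refine ⟨I, hI, v, ?_, fun j => ?_⟩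
  · by_contra! h
    have hmkQ : ∀ x, N.mkQ x = 0 := fun x => φ.injective <| by
      rw [map_zero]
      exact (hπ x).trans
        (Ideal.Quotient.eq_zero_iff_mem.mpr (sum_mem fun i _ => I.mul_mem_left _ (h i)))
    exact hN.1 (eq_top_iff.mpr fun x _ => (Submodule.Quotient.mk_eq_zero N).mp (hmkQ x))
  · have hcol : N.mkQ (M.col j) = 0 :=
      (Submodule.Quotient.mk_eq_zero N).mpr (hMN ⟨Pi.single j 1, by simp⟩)
    rw [Matrix.vecMul, dotProduct_comm, ← Ideal.Quotient.eq_zero_iff_mem]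
    exact (hπ _).symm.trans ((congrArg φ hcol).trans (map_zero φ))

/-- If `H(D)` had no right inverse, it would lose rank modulo some polynomial `g(D)` with
`g(0) ≠ 0`, so that `v(D) H(D) = g(D) w(D)` for polynomial rows `v(D)`, `w(D)` with
`v(D) / g(D)` of infinite weight. -/
theorem Noncatastrophic.exists_right_inverse {r n : ℕ} {H : Matrix (Fin r) (Fin n) (ZMod 2)[X]}
    (hH : Noncatastrophic H) : ∃ K : Matrix (Fin n) (Fin r) BLaurent,
      toLaurentMatrix H * K = 1 := by
  rw [← Matrix.mulVec_surjective_iff_exists_right_inverse]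
  by_contra hsurj
  obtain ⟨I, hI, v, ⟨i, hvi⟩, hvH⟩ := exists_isMaximal_of_not_surjective_mulVec hsurj
  obtain ⟨f, rfl⟩ := IsPrincipalIdealRing.principal I
  have hf : f ≠ 0 := by
    rintro rfl
    exact Ring.ne_bot_of_isMaximal_of_not_isField hI (not_isField_laurentPolynomial _) (by simp)
  obtain ⟨l, g, rfl, hg⟩ := exists_eq_T_mul_toLaurent hf
  have hmem : ∀ x, x ∈ Ideal.span {LaurentPolynomial.T l * Polynomial.toLaurent g} ↔
      Polynomial.toLaurent g ∣ x := fun x => by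
    rw [Ideal.mem_span_singleton, (LaurentPolynomial.isUnit_T l).mul_left_dvd]
  obtain ⟨k, p, hp⟩ := exists_toLaurent_eq_T_mul v
  have hdvd : ∀ j, g ∣ (p ᵥ* H) j := fun j => by
    apply dvd_of_toLaurent_dvd hg
    have hpH : Polynomial.toLaurent ((p ᵥ* H) j) =
        LaurentPolynomial.T k * (v ᵥ* toLaurentMatrix H) j := by
      simp only [Matrix.vecMul, dotProduct, map_sum, map_mul, hp, toLaurentMatrix,
        Matrix.map_apply, Finset.mul_sum, mul_assoc]
    exact hpH ▸ ((hmem _).mp (hvH j)).mul_left _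
  choose w hw using hdvd
  have hg' : (g : PowerSeries (ZMod 2)) * (g : PowerSeries (ZMod 2))⁻¹ = 1 :=
    PowerSeries.mul_inv_cancel _ (by simpa using hg)
  obtain ⟨q, hq⟩ := hH (fun i => (g : PowerSeries (ZMod 2))⁻¹ * p i) (fun j => ⟨w j, by
    have hwj : ∑ i, (p i : PowerSeries (ZMod 2)) * H i j = g * w j := by
      rw [← Polynomial.coe_mul, ← hw]
      simp only [Matrix.vecMul, dotProduct, ← Polynomial.coeToPowerSeries.ringHom_apply, map_sum,
        map_mul]
    simp only [mul_assoc, ← Finset.mul_sum]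
    rw [hwj, ← mul_assoc, mul_comm _ (g : PowerSeries (ZMod 2)), hg', one_mul]⟩) i
  have hpi : p i = g * q := Polynomial.coe_injective _ <| by
    rw [Polynomial.coe_mul, hq, ← mul_assoc, hg', one_mul]
  refine hvi ((hmem _).mpr ?_)
  rw [← (LaurentPolynomial.isUnit_T (k : ℤ)).dvd_mul_left, ← hp, hpi, map_mul]
  exact dvd_mul_right _ _

end Noncatastrophic

/-! ### Completing a right invertible matrix -/

theorem exists_complement {R m n : Type*} [CommRing R] [IsDomain R] [IsPrincipalIdealRing R]
    [Fintype m] [DecidableEq m] [Fintype n] [DecidableEq n] {S : Matrix m n R} {V : Matrix n m R}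
    (hSV : S * V = 1) :
    ∃ (k : ℕ) (Z : Matrix (Fin k) n R) (Y : Matrix n (Fin k) R),
      Z * V = 0 ∧ S * Y = 0 ∧ Z * Y = 1 ∧ V * S + Y * Z = 1 := by
  obtain ⟨k, ⟨b⟩⟩ := Submodule.nonempty_basis_of_pid (Pi.basisFun R n)
    (LinearMap.ker V.vecMulLinear)
  let Z : Matrix (Fin k) n R := Matrix.of fun i => b i
  have hZV : Z * V = 0 := Matrix.ext fun i => congrFun (LinearMap.mem_ker.mp (b i).2)
  have hZ : Function.Injective Z.vecMul := by
    rw [Matrix.vecMul_injective_iff]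
    exact b.linearIndependent.map' (Submodule.subtype _) (Submodule.ker_subtype _)
  have hker : ∀ i, (1 - V * S).row i ∈ LinearMap.ker V.vecMulLinear := fun i => by
    rw [LinearMap.mem_ker, Matrix.vecMulLinear_apply, Matrix.row, ← Matrix.mul_apply_eq_vecMul,
      Matrix.sub_mul, Matrix.mul_assoc, hSV, Matrix.one_mul, Matrix.mul_one, sub_self]
    rfl
  let Y : Matrix n (Fin k) R := Matrix.of fun i => b.repr ⟨_, hker i⟩
  have hYZ : Y * Z = 1 - V * S := by
    refine Matrix.ext_row fun i => ?_
    rw [Matrix.row, Matrix.mul_apply_eq_vecMul, Matrix.vecMul_eq_sum]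
    have hi := congrArg (Submodule.subtype _) (b.sum_repr ⟨_, hker i⟩)
    rwa [map_sum] at hi
  have hSYZ : S * Y * Z = (0 : Matrix m (Fin k) R) * Z := by
    rw [Matrix.mul_assoc, hYZ, Matrix.mul_sub, ← Matrix.mul_assoc, hSV, Matrix.one_mul,
      Matrix.mul_one, sub_self, Matrix.zero_mul]
  have hZYZ : Z * Y * Z = (1 : Matrix (Fin k) (Fin k) R) * Z := by
    rw [Matrix.mul_assoc, hYZ, Matrix.mul_sub, ← Matrix.mul_assoc, hZV, Matrix.zero_mul,
      Matrix.mul_one, sub_zero, Matrix.one_mul]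
  exact ⟨k, Z, Y, hZV, Matrix.ext_row fun i => hZ (congrArg (Matrix.row · i) hSYZ),
    Matrix.ext_row fun i => hZ (congrArg (Matrix.row · i) hZYZ), by rw [hYZ, add_sub_cancel]⟩

/-! ### Encoding frames -/

/-- The involution `D ↦ D⁻¹`, for which `Mᴴ` is the matrix written `Mᵀ(D⁻¹)` in coding theory. -/
noncomputable instance : StarRing BLaurent where
  star := LaurentPolynomial.invert
  star_involutive := LaurentPolynomial.involutive_invert
  star_mul f g := by rw [map_mul, mul_comm]
  star_add := map_add _

theorem fromRows_mul_fromCols_eq_one {R m m' n : Type*} [CommRing R] [DecidableEq m]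
    [Fintype m'] [DecidableEq m'] [Fintype n] [DecidableEq n] {H : Matrix m n R}
    {K : Matrix n m R} {W : Matrix m' n R} {L : Matrix n m' R} (hHK : H * K = 1) (hWL : W * L = 1)
    (hHL : H * L = 0) :
    Matrix.fromRows H W * Matrix.fromCols ((1 - L * W) * K) L = 1 := by
  have h₁ : H * ((1 - L * W) * K) = 1 := by
    rw [← Matrix.mul_assoc, Matrix.mul_sub, ← Matrix.mul_assoc, hHL, Matrix.zero_mul,
      Matrix.mul_one, sub_zero, hHK]
  have h₂ : W * ((1 - L * W) * K) = 0 := by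
    rw [← Matrix.mul_assoc, Matrix.mul_sub, ← Matrix.mul_assoc, hWL, Matrix.one_mul,
      Matrix.mul_one, sub_self, Matrix.zero_mul]
  rw [Matrix.fromRows_mul_fromCols, h₁, h₂, hWL, hHL, Matrix.fromBlocks_one]

section Frame

variable {ι α β ν : Type} [DecidableEq ι] [DecidableEq α] [DecidableEq β] [Fintype ν]
  [DecidableEq ν]

/-- The roles of the sender's qubits before encoding: halves of ebits, ancilla qubits that are
turned into generators of type `X`, ancilla qubits that yield generators of type `Z`, and
information qubits. -/
abbrev SenderQubits (ι α β κ : Type) : Type := ((ι ⊕ β) ⊕ α) ⊕ κ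

/-- The linear algebra behind an encoder of the CSS code with the check matrices `H₁`, `H₂`: the
rows of `xRows` and `zRows` are the types `X` and `Z` of dual families of Pauli sequences, one for
each of the sender's qubits, that contain the rows of `H₂` and, up to the factors `γ` and the
multiples `coupling` of the rows that belong to information qubits, the rows of `H₁`. -/
structure EncodingFrame (H₁ : Matrix (ι ⊕ α) ν BLaurent) (H₂ : Matrix (ι ⊕ β) ν BLaurent)
    (γ : ι → BLaurent) (κ : Type) [Fintype κ] where
  qubit : SenderQubits ι α β κ ≃ ν
  xRows : Matrix ν ν BLaurent
  zRows : Matrix ν ν BLaurent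
  coupling : Matrix κ ι BLaurent
  xRows_mul_zRows : xRows * zRowsᴴ = 1
  xRows_ebit : ∀ a, xRows (qubit (.inl (.inl (.inl a)))) = H₂ (.inl a)
  xRows_ancilla : ∀ b, xRows (qubit (.inl (.inl (.inr b)))) = H₂ (.inr b)
  check_ebit : ∀ a, H₁ (.inl a) = γ a • zRows (qubit (.inl (.inl (.inl a)))) +
    ∑ i, star (coupling i a) • zRows (qubit (.inr i))
  check_ancilla : ∀ b, H₁ (.inr b) = zRows (qubit (.inl (.inr b)))

variable {H₁ : Matrix (ι ⊕ α) ν BLaurent} {H₂ : Matrix (ι ⊕ β) ν BLaurent} {γ : ι → BLaurent}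

/-- The products of the rows of type `X` of an encoding frame with the rows of `H₁`. -/
noncomputable abbrev frameOverlap (α β : Type) [DecidableEq α] {κ : Type} (γ : ι → BLaurent)
    (P : Matrix κ ι BLaurent) : Matrix (((ι ⊕ β) ⊕ α) ⊕ κ) (ι ⊕ α) BLaurent :=
  Matrix.fromRows (Matrix.fromRows (paddedDiagonal α β γ)ᴴ (Matrix.fromCols 0 1))
    (Matrix.fromCols P 0)

/-- The rows of `H₂` are completed by the rows `W` dual to the last columns of `H₁ᴴ` and by a basis
`Z` of the remaining rows; the expansion of `H₁` in the dual basis is read off `H₁ H₂ᴴ`. -/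
theorem exists_completion_of_mul_conjTranspose_eq [Fintype ι] [Fintype α] [Fintype β]
    {K₁ : Matrix ν (ι ⊕ α) BLaurent} {K₂ : Matrix ν (ι ⊕ β) BLaurent}
    (hK₁ : H₁ * K₁ = 1) (hK₂ : H₂ * K₂ = 1) (hH : H₁ * H₂ᴴ = paddedDiagonal α β γ) :
    ∃ (k : ℕ) (W : Matrix α ν BLaurent) (Z : Matrix (Fin k) ν BLaurent)
      (T' : Matrix ν (((ι ⊕ β) ⊕ α) ⊕ Fin k) BLaurent) (P : Matrix (Fin k) ι BLaurent),
      Matrix.fromRows (Matrix.fromRows H₂ W) Z * T' = 1 ∧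
      T' * Matrix.fromRows (Matrix.fromRows H₂ W) Z = 1 ∧
      Matrix.fromRows (Matrix.fromRows H₂ W) Z * H₁ᴴ = frameOverlap α β γ P := by
  let L : Matrix ν α BLaurent := H₁ᴴ.toCols₂
  let W : Matrix α ν BLaurent := K₁ᴴ.toRows₂
  have hH₂ : H₂ * H₁ᴴ = (paddedDiagonal α β γ)ᴴ := by
    rw [← hH, Matrix.conjTranspose_mul, Matrix.conjTranspose_conjTranspose]
  have hW : W * H₁ᴴ = Matrix.fromCols 0 1 := by
    have h : K₁ᴴ * H₁ᴴ = 1 := by rw [← Matrix.conjTranspose_mul, hK₁, Matrix.conjTranspose_one]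
    ext1 i j
    refine (congrFun (congrFun h (.inr i)) j).trans ?_
    cases j <;> simp [Matrix.one_apply]
  have hWL : W * L = 1 := Matrix.ext fun i j => congrFun (congrFun hW i) (.inr j)
  have hHL : H₂ * L = 0 := Matrix.ext fun i j => by
    refine (congrFun (congrFun hH₂ i) (.inr j)).trans ?_
    cases i <;> simp
  have hSV := fromRows_mul_fromCols_eq_one hK₂ hWL hHL
  obtain ⟨k, Z, Y, hZV, hSY, hZY, hsum⟩ := exists_complement hSV
  have hZL : Z * L = 0 := by
    rw [Matrix.mul_fromCols] at hZV
    exact Matrix.ext fun i b => congrFun (congrFun hZV i) (.inr b)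
  have hZ : Z * H₁ᴴ = Matrix.fromCols (Z * H₁ᴴ).toCols₁ 0 := by
    rw [← hZL]
    exact (Matrix.fromCols_toCols _).symm
  refine ⟨k, W, Z, Matrix.fromCols (Matrix.fromCols ((1 - L * W) * K₂) L) Y,
    (Z * H₁ᴴ).toCols₁, ?_, ?_, ?_⟩
  · rw [Matrix.fromRows_mul_fromCols, hSV, hSY, hZV, hZY, Matrix.fromBlocks_one]
  · rw [Matrix.fromCols_mul_fromRows, hsum]
  · rw [Matrix.fromRows_mul, Matrix.fromRows_mul, hH₂, hW, hZ]
    rfl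

theorem exists_encodingFrame [Finite ι] [Finite α] [Finite β]
    {K₁ : Matrix ν (ι ⊕ α) BLaurent} {K₂ : Matrix ν (ι ⊕ β) BLaurent}
    (hK₁ : H₁ * K₁ = 1) (hK₂ : H₂ * K₂ = 1) (hH : H₁ * H₂ᴴ = paddedDiagonal α β γ) :
    ∃ k, Nonempty (EncodingFrame H₁ H₂ γ (Fin k)) := by
  cases nonempty_fintype ι
  cases nonempty_fintype α
  cases nonempty_fintype β
  obtain ⟨k, W, Z, T', P, hTT', hT'T, hT⟩ := exists_completion_of_mul_conjTranspose_eq hK₁ hK₂ hH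
  let e : SenderQubits ι α β (Fin k) ≃ ν :=
    Fintype.equivOfCardEq (Matrix.square_of_invertible _ _ hTT' hT'T)
  have hH₁ : H₁ᴴ = T' * frameOverlap α β γ P := by
    rw [← hT, ← Matrix.mul_assoc, hT'T, Matrix.one_mul]
  refine ⟨k, ⟨⟨e, (Matrix.fromRows (Matrix.fromRows H₂ W) Z).submatrix e.symm id,
    T'ᴴ.submatrix e.symm id, P, ?_, ?_, ?_, ?_, ?_⟩⟩⟩
  · rw [Matrix.conjTranspose_submatrix, Matrix.conjTranspose_conjTranspose,
      ← Matrix.submatrix_mul _ _ _ _ _ Function.bijective_id, hTT', Matrix.submatrix_one_equiv]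
  · intro a
    funext j
    simp
  · intro b
    funext j
    simp
  · intro a
    funext j
    apply star_injective
    refine (congrFun (congrFun hH₁ j) (.inl a)).trans ?_
    simp [Matrix.mul_apply, Fintype.sum_sum_type, Matrix.fromBlocks_conjTranspose, mul_comm,
      Matrix.diagonal_apply]
  · intro b
    funext j
    apply star_injective
    refine (congrFun (congrFun hH₁ j) (.inr b)).trans ?_
    simp [Matrix.mul_apply, Fintype.sum_sum_type, Matrix.fromBlocks_conjTranspose, Matrix.one_apply]

end Frame

/-! ### Circuits that act separately on the parts `X` and `Z` -/

section Circuits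

variable {Q : Type}

theorem Circuit.finiteDepth_singleton {g : Gate Q} (hg : g.FiniteDepth) :
    Circuit.FiniteDepth [g] := by
  simpa only [Circuit.FiniteDepth, List.forall_mem_singleton] using hg

theorem Circuit.FiniteDepth.append {C C' : Circuit Q} (h : C.FiniteDepth) (h' : C'.FiniteDepth) :
    Circuit.FiniteDepth (C ++ C') :=
  List.forall_mem_append.mpr ⟨h, h'⟩

theorem Circuit.act_append [DecidableEq Q] (C C' : Circuit Q) (u : PauliRow Q) :
    Circuit.act (C ++ C') u = C'.act (C.act u) :=
  List.foldl_append ..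

theorem exists_finiteDepth_hadamard [DecidableEq Q] (s : Finset Q) :
    ∃ C : Circuit Q, C.FiniteDepth ∧ (∀ q ∈ s, C.act (pauliZ q) = pauliX q) ∧
      ∀ q ∉ s, C.act (pauliZ q) = pauliZ q ∧ C.act (pauliX q) = pauliX q := by
  induction s using Finset.induction_on with
  | empty => exact ⟨[], List.forall_mem_nil _, fun _ hq => absurd hq (Finset.notMem_empty _),
      fun _ _ => ⟨rfl, rfl⟩⟩
  | insert a s ha ih =>
    obtain ⟨C, hfd, hmem, hnotMem⟩ := ih
    have hself : (Gate.hadamard a).act (pauliZ a) = pauliX a := by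
      funext t
      rcases t with t | t <;> rcases eq_or_ne t a with rfl | ht <;>
        simp_all [Gate.act, pauliZ, pauliX]
    have hZ : ∀ q ≠ a, (Gate.hadamard a).act (pauliZ q) = pauliZ q := fun q hq => by
      funext t
      rcases t with t | t <;> rcases eq_or_ne t a with rfl | ht <;>
        simp_all [Gate.act, pauliZ, hq.symm]
    have hX : ∀ q ≠ a, (Gate.hadamard a).act (pauliX q) = pauliX q := fun q hq => by
      funext t
      rcases t with t | t <;> rcases eq_or_ne t a with rfl | ht <;>
        simp_all [Gate.act, pauliX, hq.symm]
    refine ⟨C ++ [Gate.hadamard a], hfd.append (Circuit.finiteDepth_singleton trivial),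
      fun q hq => ?_, fun q hq => ?_⟩
    · rw [Circuit.act_append]
      rcases Finset.mem_insert.mp hq with rfl | hq
      · rw [(hnotMem q ha).1]
        exact hself
      · rw [hmem q hq]
        exact hX q (ne_of_mem_of_not_mem hq ha)
    · obtain ⟨hqa, hqs⟩ := not_or.mp (Finset.mem_insert.not.mp hq)
      rw [Circuit.act_append, Circuit.act_append, (hnotMem q hqs).1, (hnotMem q hqs).2]
      exact ⟨hZ q hqa, hX q hqa⟩

variable [Fintype Q]

/-- The operation `[z | x] ↦ [z Z | x X]` on Pauli sequences. -/
noncomputable def cssAct (X Z : Matrix Q Q BRat) (u : PauliRow Q) : PauliRow Q :=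
  Sum.elim ((fun q => u (Sum.inl q)) ᵥ* Z) ((fun q => u (Sum.inr q)) ᵥ* X)

theorem cssAct_mul (X X' Z Z' : Matrix Q Q BRat) (u : PauliRow Q) :
    cssAct (X * X') (Z * Z') u = cssAct X' Z' (cssAct X Z u) := by
  simp only [cssAct, Sum.elim_inl, Sum.elim_inr, ← Matrix.vecMul_vecMul]

variable [DecidableEq Q]

/-- The circuit `C` acts on Pauli sequences by `[z | x] ↦ [z Z | x X]`. -/
def Circuit.Implements (C : Circuit Q) (X Z : Matrix Q Q BRat) : Prop :=
  ∀ u, C.act u = cssAct X Z u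

theorem Circuit.implements_nil : Circuit.Implements ([] : Circuit Q) 1 1 := fun u => by
  funext s
  rcases s with s | s <;> simp [Circuit.act, cssAct]

theorem Circuit.Implements.append {C C' : Circuit Q} {X X' Z Z' : Matrix Q Q BRat}
    (h : C.Implements X Z) (h' : C'.Implements X' Z') :
    Circuit.Implements (C ++ C') (X * X') (Z * Z') := fun u => by
  rw [Circuit.act_append, h, h', cssAct_mul]

/-- The circuit `C` multiplies the entries `z_q` of Pauli sequences by `γ q`, and correspondingly
divides the entries `x_q` by `γ q (D⁻¹)`. -/
def Circuit.Scales (C : Circuit Q) (γ : Q → BLaurent) : Prop :=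
  C.Implements (Matrix.diagonal fun q => (toRat (star (γ q)))⁻¹)
    (Matrix.diagonal fun q => toRat (γ q))

theorem Circuit.scales_nil : Circuit.Scales ([] : Circuit Q) 1 := by
  simpa [Circuit.Scales] using Circuit.implements_nil

theorem Circuit.Scales.append {C C' : Circuit Q} {γ γ' : Q → BLaurent} (h : C.Scales γ)
    (h' : C'.Scales γ') : Circuit.Scales (C ++ C') (γ * γ') := by
  have h'' := Circuit.Implements.append h h'
  simp only [Matrix.diagonal_mul_diagonal] at h''
  simpa only [Circuit.Scales, Pi.mul_apply, star_mul', map_mul, mul_inv] using h''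

theorem toRat_T_neg (l : ℤ) :
    toRat (LaurentPolynomial.T (-l)) = (toRat (LaurentPolynomial.T l))⁻¹ :=
  eq_inv_of_mul_eq_one_left (by rw [← map_mul, ← LaurentPolynomial.T_add]; simp)

theorem star_T (l : ℤ) : star (LaurentPolynomial.T l : BLaurent) = LaurentPolynomial.T (-l) :=
  LaurentPolynomial.invert_T l

theorem scales_delay (i : Q) (l : ℤ) :
    Circuit.Scales [Gate.delay i l] (Pi.mulSingle i (LaurentPolynomial.T l)) := fun u => by
  funext s
  rcases s with s | s <;> rcases eq_or_ne s i with rfl | hs <;>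
    simp_all [Circuit.act, Gate.act, cssAct, Matrix.vecMul_diagonal, delayPow, star_T, toRat_T_neg,
      mul_comm]

theorem scales_infiniteDepth (i : Q) {f : (ZMod 2)[X]} (hf : f.coeff 0 = 1) :
    Circuit.Scales [Gate.infiniteDepth i f hf]
      (Pi.mulSingle i (star (Polynomial.toLaurent f))) := fun u => by
  have hstar : LaurentPolynomial.invert (Polynomial.toLaurent f) =
      star (Polynomial.toLaurent f) := rfl
  funext s
  rcases s with s | s <;> rcases eq_or_ne s i with rfl | hs <;>
    simp_all [Circuit.act, Gate.act, cssAct, Matrix.vecMul_diagonal, mul_comm, div_eq_mul_inv]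

theorem exists_finiteDepth_scales (l : Q → ℤ) :
    ∃ C : Circuit Q, C.FiniteDepth ∧ C.Scales fun q => LaurentPolynomial.T (l q) := by
  rw [← Finset.univ_prod_mulSingle fun q => (LaurentPolynomial.T (l q) : BLaurent)]
  refine Finset.prod_induction _ (fun γ => ∃ C : Circuit Q, C.FiniteDepth ∧ C.Scales γ) ?_
    ⟨[], List.forall_mem_nil _, Circuit.scales_nil⟩ fun q _ =>
    ⟨[.delay q (l q)], Circuit.finiteDepth_singleton trivial, scales_delay q (l q)⟩
  rintro γ γ' ⟨C, hfd, hC⟩ ⟨C', hfd', hC'⟩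
  exact ⟨C ++ C', hfd.append hfd', hC.append hC'⟩

theorem exists_scales {γ : Q → BLaurent} (hγ : ∀ q, γ q ≠ 0) : ∃ C : Circuit Q, C.Scales γ := by
  rw [← Finset.univ_prod_mulSingle γ]
  refine Finset.prod_induction _ (fun γ => ∃ C : Circuit Q, C.Scales γ) ?_
    ⟨[], Circuit.scales_nil⟩ fun q _ => ?_
  · rintro γ γ' ⟨C, hC⟩ ⟨C', hC'⟩
    exact ⟨C ++ C', hC.append hC'⟩
  · obtain ⟨l, g, hg, hl⟩ := exists_eq_T_mul_toLaurent (star_ne_zero.mpr (hγ q))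
    have hγl : γ q = LaurentPolynomial.T (-l) * star (Polynomial.toLaurent g) := by
      rw [← star_star (γ q), hg, star_mul', star_T]
    rw [hγl, Pi.mulSingle_mul]
    exact ⟨_, (scales_delay q (-l)).append
      (scales_infiniteDepth q (Fin.eq_one_of_ne_zero _ hl))⟩

variable (Q) in
/-- The matrices `M(D)` for which a finite-depth circuit multiplies the parts `X` of Pauli sequences
by `M(D)` and the parts `Z` by the conjugate transpose of its inverse. -/
def finiteDepthMatrices : Submonoid (Matrix Q Q BLaurent) where
  carrier := {M | ∃ (C : Circuit Q) (N : Matrix Q Q BLaurent), C.FiniteDepth ∧ M * N = 1 ∧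
    C.Implements (M.map toRat) (Nᴴ.map toRat)}
  one_mem' := ⟨[], 1, List.forall_mem_nil _, one_mul 1, by
    simpa [Matrix.map_one] using Circuit.implements_nil⟩
  mul_mem' := by
    rintro M M' ⟨C, N, hfd, hMN, hC⟩ ⟨C', N', hfd', hMN', hC'⟩
    refine ⟨C ++ C', N' * N, hfd.append hfd', ?_, ?_⟩
    · rw [Matrix.mul_assoc, ← Matrix.mul_assoc M', hMN', Matrix.one_mul, hMN]
    · simpa only [Matrix.conjTranspose_mul, Matrix.map_mul] using hC.append hC'

instance : CharP BLaurent 2 :=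
  charP_of_injective_algebraMap (algebraMap (ZMod 2) BLaurent).injective 2

theorem vecMul_transvection {R : Type*} [CommRing R] (x : Q → R) (i j : Q) (a : R) :
    x ᵥ* Matrix.transvection i j a = x + Pi.single j (x i * a) := by
  funext q
  rw [Matrix.transvection, Matrix.vecMul_add, Matrix.vecMul_one]
  simp [Matrix.vecMul, dotProduct, Matrix.single_apply, Pi.single_apply, ite_and, eq_comm]

theorem transvection_T_mem_finiteDepthMatrices {i j : Q} (hij : i ≠ j) (k : ℤ) :
    Matrix.transvection i j (LaurentPolynomial.T k) ∈ finiteDepthMatrices Q := by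
  refine ⟨[Gate.cnot i j k hij], Matrix.transvection i j (LaurentPolynomial.T k),
    Circuit.finiteDepth_singleton trivial, ?_, fun u => ?_⟩
  · rw [Matrix.transvection_mul_transvection_same _ _ hij, CharTwo.add_self_eq_zero,
      Matrix.transvection_zero]
  · funext s
    rcases s with s | s
    · have h : (Matrix.transvection i j (LaurentPolynomial.T k : BLaurent))ᴴ.map toRat =
          Matrix.transvection j i (delayPow (-k)) := by
        simp [Matrix.transvection, Matrix.map_add, star_T, delayPow]
      simp [Circuit.act, Gate.act, cssAct, h, vecMul_transvection, Pi.single_apply, mul_comm]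
    · have h : (Matrix.transvection i j (LaurentPolynomial.T k : BLaurent)).map toRat =
          Matrix.transvection i j (delayPow k) := by
        simp [Matrix.transvection, Matrix.map_add, delayPow]
      simp [Circuit.act, Gate.act, cssAct, h, vecMul_transvection, Pi.single_apply, mul_comm]

theorem transvection_mem_finiteDepthMatrices {i j : Q} (hij : i ≠ j) (a : BLaurent) :
    Matrix.transvection i j a ∈ finiteDepthMatrices Q := by
  induction a using LaurentPolynomial.induction_on' with
  | add p q hp hq =>
    rw [← Matrix.transvection_mul_transvection_same _ _ hij]
    exact mul_mem hp hq
  | C_mul_T n a =>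
    obtain rfl | rfl : a = 0 ∨ a = 1 := by revert a; decide
    · simp [one_mem]
    · simpa using transvection_T_mem_finiteDepthMatrices hij n

theorem diagonal_T_mem_finiteDepthMatrices (l : Q → ℤ) :
    (Matrix.diagonal fun q => LaurentPolynomial.T (l q)) ∈ finiteDepthMatrices Q := by
  obtain ⟨C, hfd, hC⟩ := exists_finiteDepth_scales l
  refine ⟨C, Matrix.diagonal fun q => LaurentPolynomial.T (-l q), hfd, ?_, ?_⟩
  · simp only [Matrix.diagonal_mul_diagonal, ← LaurentPolynomial.T_add, add_neg_cancel,
      LaurentPolynomial.T_zero, Matrix.diagonal_one]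
  · rw [Matrix.diagonal_conjTranspose, Pi.star_def, Matrix.diagonal_map (map_zero toRat),
      Matrix.diagonal_map (map_zero toRat)]
    have hstar : ∀ q, toRat (star (LaurentPolynomial.T (-l q))) =
        toRat (LaurentPolynomial.T (l q)) := fun q => by rw [star_T, neg_neg]
    have hinv : ∀ q, (toRat (star (LaurentPolynomial.T (l q))))⁻¹ =
        toRat (LaurentPolynomial.T (l q)) := fun q => by rw [star_T, toRat_T_neg, inv_inv]
    rw [Circuit.Scales, funext hinv] at hC
    exact (congrArg (C.Implements _) (congrArg Matrix.diagonal (funext hstar))).mpr hC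

theorem exists_finiteDepth_implements {M N : Matrix Q Q BLaurent} (hMN : M * N = 1) :
    ∃ C : Circuit Q, C.FiniteDepth ∧ C.Implements (M.map toRat) (Nᴴ.map toRat) := by
  have helem : elementary Q BLaurent ≤ finiteDepthMatrices Q := Submonoid.closure_le.mpr <| by
    rintro _ ⟨t, rfl⟩
    exact transvection_mem_finiteDepthMatrices t.hij t.c
  obtain ⟨A, hA, B, hB, l, rfl⟩ := exists_eq_mul_diagonal_T_mul_of_isUnit
    (IsUnit.of_mul_eq_one N hMN)
  obtain ⟨C, N', hfd, hMN', hC⟩ := mul_mem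
    (mul_mem (helem hA) (diagonal_T_mem_finiteDepthMatrices l)) (helem hB)
  obtain rfl : N' = N := left_inv_eq_right_inv (mul_eq_one_comm.mp hMN') hMN
  exact ⟨C, hfd, hC⟩

end Circuits

/-! ### Pauli sequences of one type and circuits on a part of the frame -/

section Rows

variable {Q Q' : Type}

theorem Gate.isLinearMap_act [DecidableEq Q] (g : Gate Q) : IsLinearMap BRat g.act where
  map_add u v := by
    cases g <;> funext s <;>
      simp only [Gate.act, Pi.add_apply, Pi.single_apply, Function.update_apply] <;>
      split_ifs <;> ring
  map_smul r u := by
    cases g <;> funext s <;>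
      simp only [Gate.act, Pi.add_apply, Pi.smul_apply, Pi.single_apply, Function.update_apply,
        smul_eq_mul] <;>
      split_ifs <;> ring

theorem Circuit.isLinearMap_act [DecidableEq Q] (C : Circuit Q) : IsLinearMap BRat C.act := by
  induction C with
  | nil => exact LinearMap.id.isLinear
  | cons g C ih => exact (ih.mk' _ ∘ₗ g.isLinearMap_act.mk' _).isLinear

theorem Circuit.act_add_sum_smul [DecidableEq Q] {ι : Type*} [Fintype ι] (C : Circuit Q)
    (u : PauliRow Q) (r : ι → BRat) (v : ι → PauliRow Q) :
    C.act (u + ∑ i, r i • v i) = C.act u + ∑ i, r i • C.act (v i) := by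
  let L := C.isLinearMap_act.mk' C.act
  change L (u + ∑ i, r i • v i) = L u + ∑ i, r i • L (v i)
  simp only [map_add, map_sum, map_smul]

/-- The finite-weight Pauli sequence `[v | 0]`. -/
noncomputable def zRow (v : Q → BLaurent) : PauliRow Q := Sum.elim (fun q => toRat (v q)) 0

/-- The finite-weight Pauli sequence `[0 | v]`. -/
noncomputable def xRow (v : Q → BLaurent) : PauliRow Q := Sum.elim 0 fun q => toRat (v q)

theorem zRow_single_one [DecidableEq Q] (q : Q) : zRow (Pi.single q 1) = pauliZ q := by
  funext s
  rcases s with s | s <;> rcases eq_or_ne s q with rfl | hs <;> simp_all [zRow, pauliZ]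

theorem xRow_single [DecidableEq Q] (q : Q) (f : BLaurent) :
    xRow (Pi.single q f) = toRat f • pauliX q := by
  funext s
  rcases s with s | s <;> rcases eq_or_ne s q with rfl | hs <;> simp_all [xRow, pauliX]

theorem xRow_single_one [DecidableEq Q] (q : Q) : xRow (Pi.single q 1) = pauliX q := by
  rw [xRow_single, map_one, one_smul]

theorem zRow_zero : zRow (0 : Q → BLaurent) = 0 := by
  funext s
  rcases s with s | s <;> simp [zRow]

theorem xRow_zero : xRow (0 : Q → BLaurent) = 0 := by
  funext s
  rcases s with s | s <;> simp [xRow]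

theorem Circuit.Implements.act_zRow [Fintype Q] [DecidableEq Q] {C : Circuit Q}
    {X : Matrix Q Q BRat} {Z : Matrix Q Q BLaurent} (h : C.Implements X (Z.map toRat))
    (v : Q → BLaurent) : C.act (zRow v) = zRow (v ᵥ* Z) := by
  rw [h]
  funext s
  rcases s with s | s <;> simp [cssAct, zRow, Matrix.vecMul, dotProduct]

theorem Circuit.Implements.act_xRow [Fintype Q] [DecidableEq Q] {C : Circuit Q}
    {X : Matrix Q Q BLaurent} {Z : Matrix Q Q BRat} (h : C.Implements (X.map toRat) Z)
    (v : Q → BLaurent) : C.act (xRow v) = xRow (v ᵥ* X) := by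
  rw [h]
  funext s
  rcases s with s | s <;> simp [cssAct, xRow, Matrix.vecMul, dotProduct]

theorem Circuit.Scales.act_zRow [Fintype Q] [DecidableEq Q] {C : Circuit Q} {γ : Q → BLaurent}
    (h : C.Scales γ) (v : Q → BLaurent) : C.act (zRow v) = zRow (v * γ) := by
  rw [h]
  funext s
  rcases s with s | s <;> simp [cssAct, zRow, Matrix.vecMul_diagonal]

theorem Circuit.Scales.smul_act_pauliX [Fintype Q] [DecidableEq Q] {C : Circuit Q}
    {γ : Q → BLaurent} (h : C.Scales γ) {q : Q} (hq : γ q ≠ 0) :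
    toRat (star (γ q)) • C.act (pauliX q) = pauliX q := by
  have h0 : toRat (star (γ q)) ≠ 0 :=
    (map_ne_zero_iff toRat toRat_injective).mpr (star_ne_zero.mpr hq)
  rw [h]
  funext s
  rcases s with s | s <;> rcases eq_or_ne s q with rfl | hs <;>
    simp_all [cssAct, pauliX, Matrix.vecMul_diagonal]

/-- The Pauli sequence with the parts `u` and `v` on two sets of qubits. -/
def joinRow (u : PauliRow Q) (v : PauliRow Q') : PauliRow (Q ⊕ Q') :=
  Sum.elim (Sum.elim (fun q => u (.inl q)) fun q => v (.inl q))
    (Sum.elim (fun q => u (.inr q)) fun q => v (.inr q))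

theorem joinRow_add_sum_smul {ι : Type*} [Fintype ι] (u : PauliRow Q) (v : PauliRow Q')
    (r : ι → BRat) (u' : ι → PauliRow Q) (v' : ι → PauliRow Q') :
    joinRow (u + ∑ i, r i • u' i) (v + ∑ i, r i • v' i) =
      joinRow u v + ∑ i, r i • joinRow (u' i) (v' i) := by
  funext s
  rcases s with (s | s) | (s | s) <;> simp [joinRow, Finset.sum_apply]

theorem smul_joinRow (r : BRat) (u : PauliRow Q) (v : PauliRow Q') :
    r • joinRow u v = joinRow (r • u) (r • v) := by
  funext s
  rcases s with (s | s) | (s | s) <;> rfl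

theorem joinRow_zRow (u : Q → BLaurent) (v : Q' → BLaurent) :
    joinRow (zRow u) (zRow v) = zRow (Sum.elim u v) := by
  funext s
  rcases s with (s | s) | (s | s) <;> rfl

theorem joinRow_xRow (u : Q → BLaurent) (v : Q' → BLaurent) :
    joinRow (xRow u) (xRow v) = xRow (Sum.elim u v) := by
  funext s
  rcases s with (s | s) | (s | s) <;> rfl

variable [DecidableEq Q] [DecidableEq Q']

theorem pauliZ_inl_add_pauliZ_inr (q : Q) (q' : Q') :
    pauliZ (.inl q) + pauliZ (.inr q') = joinRow (pauliZ q) (pauliZ q') := by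
  funext s
  rcases s with (s | s) | (s | s) <;> simp [joinRow, pauliZ, Pi.single_apply]

theorem pauliX_inl_add_pauliX_inr (q : Q) (q' : Q') :
    pauliX (.inl q) + pauliX (.inr q') = joinRow (pauliX q) (pauliX q') := by
  funext s
  rcases s with (s | s) | (s | s) <;> simp [joinRow, pauliX, Pi.single_apply]

theorem pauliZ_inr (q' : Q') : pauliZ (.inr q') = joinRow (0 : PauliRow Q) (pauliZ q') := by
  funext s
  rcases s with (s | s) | (s | s) <;> simp [joinRow, pauliZ, Pi.single_apply]

theorem pauliX_inr (q' : Q') : pauliX (.inr q') = joinRow (0 : PauliRow Q) (pauliX q') := by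
  funext s
  rcases s with (s | s) | (s | s) <;> simp [joinRow, pauliX, Pi.single_apply]

end Rows

section Renaming

variable {Q Q' : Type}

/-- The operation `g` with its qubits relabelled along an embedding; it serves to regard the
sender's circuits as circuits on the whole frame. -/
def Gate.map (f : Q ↪ Q') : Gate Q → Gate Q'
  | cnot i j k h => cnot (f i) (f j) k (f.injective.ne h)
  | hadamard i => hadamard (f i)
  | phase i => phase (f i)
  | cphase i j k h => cphase (f i) (f j) k (f.injective.ne h)
  | cphaseSelf i k h => cphaseSelf (f i) k h
  | delay i l => delay (f i) l
  | infiniteDepth i p h => infiniteDepth (f i) p h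

theorem Gate.qubits_map_subset (f : Q ↪ Q') (g : Gate Q) : (g.map f).qubits ⊆ Set.range f := by
  cases g <;> simp [Gate.map, Gate.qubits, Set.insert_subset_iff]

theorem Gate.FiniteDepth.map (f : Q ↪ Q') {g : Gate Q} (h : g.FiniteDepth) :
    (g.map f).FiniteDepth := by
  cases g <;> exact h

/-- The circuit `C` with its qubits relabelled along an embedding. -/
def Circuit.map (f : Q ↪ Q') (C : Circuit Q) : Circuit Q' := List.map (Gate.map f) C

theorem Circuit.qubits_subset_of_mem_map (f : Q ↪ Q') {C : Circuit Q} :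
    ∀ g ∈ Circuit.map f C, g.qubits ⊆ Set.range f :=
  List.forall_mem_map.mpr fun g _ => g.qubits_map_subset f

theorem Circuit.FiniteDepth.map (f : Q ↪ Q') {C : Circuit Q} (h : C.FiniteDepth) :
    Circuit.FiniteDepth (Circuit.map f C) :=
  List.forall_mem_map.mpr fun g hg => (h g hg).map f

variable [DecidableEq Q] [DecidableEq Q']

theorem Gate.act_map_inr (g : Gate Q') (u : PauliRow Q) (v : PauliRow Q') :
    (g.map .inr).act (joinRow u v) = joinRow u (g.act v) := by
  funext s
  cases g <;> rcases s with (s | s) | (s | s) <;>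
    simp [Gate.map, Gate.act, joinRow, Pi.single_apply, Function.update_apply,
      -Sum.update_elim_inl, -Sum.update_elim_inr]

theorem Circuit.act_map_inr (C : Circuit Q') (u : PauliRow Q) (v : PauliRow Q') :
    Circuit.act (Circuit.map .inr C) (joinRow u v) = joinRow u (C.act v) := by
  induction C generalizing v with
  | nil => rfl
  | cons g C ih => exact (congrArg _ (g.act_map_inr u v)).trans (ih _)

end Renaming

/-! ### Encoders and decoders -/

namespace EncodingFrame

variable {ι α β ν κ : Type} [Fintype ν] [DecidableEq ν] [Fintype κ]
  {H₁ : Matrix (ι ⊕ α) ν BLaurent} {H₂ : Matrix (ι ⊕ β) ν BLaurent} {γ : ι → BLaurent}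

/-- The factors by which the first stage of the encoder multiplies the `Z` operators. -/
noncomputable def scaling (F : EncodingFrame H₁ H₂ γ κ) (q : ν) : BLaurent :=
  Sum.elim (Sum.elim (Sum.elim γ 1) 1) 1 (F.qubit.symm q)

/-- The matrix that adds to each information qubit the multiples `coupling` of the ebits. -/
noncomputable def shear (F : EncodingFrame H₁ H₂ γ κ) : Matrix ν ν BLaurent :=
  1 + (Matrix.fromBlocks 0 0 (Matrix.fromCols (Matrix.fromCols F.coupling 0) 0) 0 :
    Matrix (SenderQubits ι α β κ) (SenderQubits ι α β κ) BLaurent).submatrix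
      F.qubit.symm F.qubit.symm

theorem shear_inl (F : EncodingFrame H₁ H₂ γ κ) (t : (ι ⊕ β) ⊕ α) :
    F.shear (F.qubit (.inl t)) = Pi.single (F.qubit (.inl t)) 1 := by
  funext q
  obtain ⟨s, rfl⟩ := F.qubit.surjective q
  cases s <;> simp [shear, Matrix.one_eq_pi_single]

theorem finite_indices (F : EncodingFrame H₁ H₂ γ κ) : Finite ι ∧ Finite α ∧ Finite β := by
  have : Finite (((ι ⊕ β) ⊕ α) ⊕ κ) := .of_equiv ν F.qubit.symm
  have : Finite ((ι ⊕ β) ⊕ α) := .sum_left κ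
  have : Finite (ι ⊕ β) := .sum_left α
  exact ⟨.sum_left β, .sum_right (ι ⊕ β), .sum_right ι⟩

theorem shear_mul_shear (F : EncodingFrame H₁ H₂ γ κ) : F.shear * F.shear = 1 := by
  obtain ⟨_, _, _⟩ := F.finite_indices
  cases nonempty_fintype ι
  cases nonempty_fintype α
  cases nonempty_fintype β
  let S : Matrix (SenderQubits ι α β κ) (SenderQubits ι α β κ) BLaurent :=
    Matrix.fromBlocks 0 0 (Matrix.fromCols (Matrix.fromCols F.coupling 0) 0) 0
  have hS : S * S = 0 := by simp [S, Matrix.fromBlocks_multiply]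
  have hS' : S.submatrix F.qubit.symm F.qubit.symm * S.submatrix F.qubit.symm F.qubit.symm = 0 := by
    rw [Matrix.submatrix_mul_equiv, hS]
    rfl
  have hadd : ∀ M : Matrix ν ν BLaurent, M + M = 0 := fun M =>
    Matrix.ext fun i j => CharTwo.add_self_eq_zero (M i j)
  rw [shear, add_mul, mul_add, mul_add, hS', mul_one, mul_one, one_mul, add_zero, add_assoc, hadd,
    add_zero]

theorem conjTranspose_shear_mul_scaling_vecMul_zRows (F : EncodingFrame H₁ H₂ γ κ)
    (s : SenderQubits ι α β κ) : (F.shearᴴ (F.qubit s) * F.scaling) ᵥ* F.zRows =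
      Sum.elim (Sum.elim (Sum.elim (fun a => H₁ (.inl a))
        fun b => F.zRows (F.qubit (.inl (.inl (.inr b))))) fun b => H₁ (.inr b))
        (fun i => F.zRows (F.qubit (.inr i))) s := by
  obtain ⟨_, _, _⟩ := F.finite_indices
  cases nonempty_fintype ι
  cases nonempty_fintype α
  cases nonempty_fintype β
  classical
  funext j
  rw [Matrix.vecMul, dotProduct, ← F.qubit.sum_comp]
  rcases s with ((a | b) | b) | i <;>
    simp [shear, scaling, Fintype.sum_sum_type, F.check_ebit, F.check_ancilla, Matrix.one_apply]

theorem exists_circuit_scaled (F : EncodingFrame H₁ H₂ γ κ) (hγ : ∀ a, γ a ≠ 0) :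
    ∃ C : Circuit ν, (∀ v, C.act (zRow v) = zRow ((v * F.scaling) ᵥ* F.zRows)) ∧
      (∀ q, toRat (star (F.scaling q)) • C.act (pauliX q) = xRow (F.xRows q)) ∧
      ((∀ a, ∃ l, γ a = LaurentPolynomial.T l) → C.FiniteDepth) := by
  have hscaling : ∀ q, F.scaling q ≠ 0 := fun q => by
    unfold scaling
    rcases F.qubit.symm q with ((a | _) | _) | _
    exacts [hγ a, one_ne_zero, one_ne_zero, one_ne_zero]
  obtain ⟨C, hC, hfd⟩ : ∃ C : Circuit ν, C.Scales F.scaling ∧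
      ((∀ a, ∃ l, γ a = LaurentPolynomial.T l) → C.FiniteDepth) := by
    by_cases h : ∀ a, ∃ l, γ a = LaurentPolynomial.T l
    · choose l hl using h
      obtain ⟨C, hfd, hC⟩ := exists_finiteDepth_scales fun q =>
        Sum.elim (Sum.elim (Sum.elim l 0) 0) 0 (F.qubit.symm q)
      refine ⟨C, ?_, fun _ => hfd⟩
      convert hC using 1
      funext q
      unfold scaling
      rcases F.qubit.symm q with ((a | _) | _) | _
      exacts [hl a, LaurentPolynomial.T_zero.symm, LaurentPolynomial.T_zero.symm,
        LaurentPolynomial.T_zero.symm]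
    · obtain ⟨C, hC⟩ := exists_scales hscaling
      exact ⟨C, hC, fun h' => absurd h' h⟩
  obtain ⟨C', hfd', hC'⟩ := exists_finiteDepth_implements F.xRows_mul_zRows
  rw [Matrix.conjTranspose_conjTranspose] at hC'
  refine ⟨C ++ C', fun v => ?_, fun q => ?_, fun h => (hfd h).append hfd'⟩
  · rw [Circuit.act_append, hC.act_zRow, hC'.act_zRow]
  · rw [Circuit.act_append, ← C'.isLinearMap_act.map_smul, hC.smul_act_pauliX (hscaling q),
      ← xRow_single_one, hC'.act_xRow, Matrix.single_one_vecMul]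
    rfl

/-- The circuit `D` on all the qubits, those of the receiver being indexed by `ι`, restores the
operators of the information qubits from the rows of the frame `F`. -/
structure IsDecoder [DecidableEq ι] (F : EncodingFrame H₁ H₂ γ κ) (D : Circuit (ι ⊕ ν)) : Prop where
  finiteDepth : D.FiniteDepth
  act_zRow : ∀ i, D.act (zRow (Sum.elim 0 (F.zRows (F.qubit (.inr i))))) =
    pauliZ (.inr (F.qubit (.inr i)))
  act_xRow : ∀ i, D.act (xRow (Sum.elim (F.coupling i) (F.xRows (F.qubit (.inr i))))) =
    pauliX (.inr (F.qubit (.inr i)))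

theorem exists_isDecoder [DecidableEq ι] (F : EncodingFrame H₁ H₂ γ κ) : ∃ D, F.IsDecoder D := by
  obtain ⟨_, -, -⟩ := F.finite_indices
  cases nonempty_fintype ι
  let B : Matrix ν ι BLaurent :=
    (Matrix.fromRows 0 F.coupling).submatrix F.qubit.symm id
  let N : Matrix (ι ⊕ ν) (ι ⊕ ν) BLaurent := Matrix.fromBlocks 1 0 B F.xRows
  let M : Matrix (ι ⊕ ν) (ι ⊕ ν) BLaurent :=
    Matrix.fromBlocks 1 0 (-(F.zRowsᴴ * B)) F.zRowsᴴ
  have hNM : N * M = 1 := by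
    simp [N, M, Matrix.fromBlocks_multiply, F.xRows_mul_zRows, ← Matrix.mul_assoc]
  have hrow : ∀ i, N (.inr (F.qubit (.inr i))) =
      Sum.elim (F.coupling i) (F.xRows (F.qubit (.inr i))) := fun i => by
    funext s
    cases s <;> simp [N, B]
  have hzRow : ∀ q, Sum.elim 0 (F.zRows q) ᵥ* Nᴴ = Pi.single (.inr q) 1 := fun q => by
    have h : F.zRows * F.xRowsᴴ = 1 := by
      rw [← Matrix.conjTranspose_conjTranspose F.zRows, ← Matrix.conjTranspose_mul,
        F.xRows_mul_zRows, Matrix.conjTranspose_one]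
    rw [Matrix.fromBlocks_conjTranspose, Matrix.vecMul_fromBlocks]
    have hq : F.zRows q ᵥ* F.xRowsᴴ = Pi.single q 1 := by
      rw [← Matrix.mul_apply_eq_vecMul, h]
      funext q'
      simp [Matrix.one_apply, Pi.single_apply, eq_comm]
    funext s
    rcases s with s | s <;> simp [hq, Pi.single_apply]
  obtain ⟨D, hfd, hD⟩ := exists_finiteDepth_implements (mul_eq_one_comm.mp hNM)
  refine ⟨D, hfd, fun i => ?_, fun i => ?_⟩
  · rw [hD.act_zRow, hzRow, zRow_single_one]
  · rw [hD.act_xRow, ← hrow, ← Matrix.mul_apply_eq_vecMul, hNM, ← xRow_single_one]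
    congr 1
    funext s
    simp [Matrix.one_apply, Pi.single_apply, eq_comm]

variable [Fintype ι]

/-- The circuit `E` on the sender's qubits encodes along the frame `F`: the initial `Z` operators of
ebits and ancilla qubits become the rows of `H₁` and the last rows of `H₂`, the `X` operators of
ebits become the first rows of `H₂` divided by `γ(D⁻¹)`, and the operators of the information qubits
are mapped to the rows of the frame, up to multiples of stabilizer generators. -/
structure IsEncoder (F : EncodingFrame H₁ H₂ γ κ) (E : Circuit ν) : Prop where
  act_pauliZ_ebit : ∀ a, E.act (pauliZ (F.qubit (.inl (.inl (.inl a))))) = zRow (H₁ (.inl a))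
  smul_act_pauliX_ebit : ∀ a, toRat (star (γ a)) • E.act (pauliX (F.qubit (.inl (.inl (.inl a))))) =
    xRow (H₂ (.inl a))
  act_pauliZ_xAncilla : ∀ b, E.act (pauliZ (F.qubit (.inl (.inl (.inr b))))) = xRow (H₂ (.inr b))
  act_pauliZ_zAncilla : ∀ b, E.act (pauliZ (F.qubit (.inl (.inr b)))) = zRow (H₁ (.inr b))
  act_pauliZ_info : ∀ i, E.act (pauliZ (F.qubit (.inr i))) = zRow (F.zRows (F.qubit (.inr i)))
  act_pauliX_info : ∀ i, E.act (pauliX (F.qubit (.inr i))) =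
    xRow (F.xRows (F.qubit (.inr i))) +
      ∑ a, toRat (F.coupling i a) • E.act (pauliX (F.qubit (.inl (.inl (.inl a)))))

theorem xRow_shear_info (F : EncodingFrame H₁ H₂ γ κ) (i : κ) :
    xRow (F.shear (F.qubit (.inr i))) = pauliX (F.qubit (.inr i)) +
      ∑ a, toRat (F.coupling i a) • pauliX (F.qubit (.inl (.inl (.inl a)))) := by
  classical
  funext s
  rcases s with q | q <;> obtain ⟨s, rfl⟩ := F.qubit.surjective q
  · simp [xRow, pauliX, Finset.sum_apply]
  · rcases s with ((a | b) | b) | j <;>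
      simp [shear, xRow, pauliX, Finset.sum_apply, Pi.single_apply, Matrix.one_apply, eq_comm,
        apply_ite toRat]

theorem exists_isEncoder (F : EncodingFrame H₁ H₂ γ κ) (hγ : ∀ a, γ a ≠ 0) :
    ∃ E, F.IsEncoder E ∧ ((∀ a, ∃ l, γ a = LaurentPolynomial.T l) → E.FiniteDepth) := by
  obtain ⟨-, -, _⟩ := F.finite_indices
  cases nonempty_fintype β
  obtain ⟨Ch, hfdh, hmem, hnotMem⟩ := exists_finiteDepth_hadamard
    (Finset.univ.image fun b : β => F.qubit (.inl (.inl (.inr b))))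
  obtain ⟨Cs, hfds, hCs⟩ := exists_finiteDepth_implements F.shear_mul_shear
  obtain ⟨C, hCZ, hCX, hfd⟩ := F.exists_circuit_scaled hγ
  have hCsX : ∀ t : (ι ⊕ β) ⊕ α, Cs.act (pauliX (F.qubit (.inl t))) = pauliX (F.qubit (.inl t)) :=
    fun t => by
      rw [← xRow_single_one, hCs.act_xRow, Matrix.single_one_vecMul, Matrix.row, F.shear_inl]
  have hZ : ∀ s, F.qubit s ∉ Finset.univ.image (fun b : β => F.qubit (.inl (.inl (.inr b)))) →
      Circuit.act (Ch ++ Cs ++ C) (pauliZ (F.qubit s)) =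
        zRow ((F.shearᴴ (F.qubit s) * F.scaling) ᵥ* F.zRows) := fun s hs => by
    rw [Circuit.act_append, Circuit.act_append, (hnotMem _ hs).1, ← zRow_single_one, hCs.act_zRow,
      hCZ, Matrix.single_one_vecMul]
    rfl
  have hX : ∀ a, Circuit.act (Ch ++ Cs ++ C) (pauliX (F.qubit (.inl (.inl (.inl a))))) =
      C.act (pauliX (F.qubit (.inl (.inl (.inl a))))) := fun a => by
    rw [Circuit.act_append, Circuit.act_append, (hnotMem _ (by simp)).2, hCsX]
  have hCX_one : ∀ s, F.scaling (F.qubit s) = 1 →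
      C.act (pauliX (F.qubit s)) = xRow (F.xRows (F.qubit s)) := fun s hs => by
    rw [← hCX, hs, star_one, map_one, one_smul]
  refine ⟨Ch ++ Cs ++ C, ⟨fun a => ?_, fun a => ?_, fun b => ?_, fun b => ?_, fun i => ?_,
    fun i => ?_⟩, fun h => (hfdh.append hfds).append (hfd h)⟩
  · rw [hZ _ (by simp), F.conjTranspose_shear_mul_scaling_vecMul_zRows]
    rfl
  · rw [hX, ← F.xRows_ebit, ← hCX]
    simp [scaling]
  · rw [Circuit.act_append, Circuit.act_append, hmem _ (by simp), hCsX, ← F.xRows_ancilla]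
    exact hCX_one _ (by simp [scaling])
  · rw [hZ _ (by simp), F.conjTranspose_shear_mul_scaling_vecMul_zRows]
    rfl
  · rw [hZ _ (by simp), F.conjTranspose_shear_mul_scaling_vecMul_zRows]
    rfl
  · simp only [hX]
    rw [Circuit.act_append, Circuit.act_append, (hnotMem _ (by simp)).2, ← xRow_single_one,
      hCs.act_xRow, Matrix.single_one_vecMul, Matrix.row, F.xRow_shear_info,
      Circuit.act_add_sum_smul, hCX_one _ (by simp [scaling])]

end EncodingFrame

/-! ### The code of an encoding frame -/

theorem shiftedSymp_fromBlocks {ι₁ ι₂ Q : Type} [Fintype Q] {Z : Matrix ι₁ Q BLaurent}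
    {X : Matrix ι₂ Q BLaurent} (h : Z * Xᴴ = 0) (i j : ι₁ ⊕ ι₂) :
    shiftedSymp (Matrix.fromBlocks Z 0 0 X i) (Matrix.fromBlocks Z 0 0 X j) = 0 := by
  have hZX : ∀ i j, ∑ q, Z i q * LaurentPolynomial.invert (X j q) = 0 := fun i j =>
    congrFun (congrFun h i) j
  have hXZ : ∀ i j, ∑ q, X i q * LaurentPolynomial.invert (Z j q) = 0 := fun i j => by
    have h' : X * Zᴴ = 0 := by
      rw [← Matrix.conjTranspose_conjTranspose X, ← Matrix.conjTranspose_mul, h,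
        Matrix.conjTranspose_zero]
    exact congrFun (congrFun h' i) j
  rcases i with i | i <;> rcases j with j | j <;> simp [shiftedSymp, hZX, hXZ]

/-- The rows of `[H₁ 0 | 0 H₂]` extended to the receiver's halves `ι` of the ebits; when
`H₁(D) H₂ᵀ(D⁻¹)` is `diag(γ, 0)`, these extensions commute. -/
noncomputable def extendedCheckMatrix {ι α β ν : Type} [DecidableEq ι]
    (H₁ : Matrix (ι ⊕ α) ν BLaurent) (H₂ : Matrix (ι ⊕ β) ν BLaurent) (γ : ι → BLaurent) :
    Matrix ((ι ⊕ α) ⊕ (ι ⊕ β)) ((ι ⊕ ν) ⊕ (ι ⊕ ν)) BLaurent :=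
  Matrix.fromBlocks (Matrix.fromCols (Matrix.fromRows 1 0) H₁) 0 0
    (Matrix.fromCols (Matrix.fromRows (Matrix.diagonal (star γ)) 0) H₂)

theorem toRat_extendedCheckMatrix {ι α β ν : Type} [DecidableEq ι]
    (H₁ : Matrix (ι ⊕ α) ν BLaurent) (H₂ : Matrix (ι ⊕ β) ν BLaurent) (γ : ι → BLaurent)
    (t : (ι ⊕ α) ⊕ (ι ⊕ β)) :
    (fun q => toRat (extendedCheckMatrix H₁ H₂ γ t q)) =
      Sum.elim
        (Sum.elim (fun a => zRow (Sum.elim (Pi.single a 1) (H₁ (.inl a))))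
          fun b => zRow (Sum.elim 0 (H₁ (.inr b))))
        (Sum.elim (fun a => xRow (Sum.elim (Pi.single a (star (γ a))) (H₂ (.inl a))))
          fun b => xRow (Sum.elim 0 (H₂ (.inr b)))) t := by
  funext q
  rcases t with (t | t) | (t | t) <;> rcases q with (q | q) | (q | q) <;>
    simp [extendedCheckMatrix, zRow, xRow, Matrix.one_eq_pi_single, Matrix.diagonal_apply,
      Pi.single_apply, eq_comm]

theorem shiftedSymp_extendedCheckMatrix {ι α β ν : Type} [Fintype ι] [DecidableEq ι] [Fintype ν]
    {H₁ : Matrix (ι ⊕ α) ν BLaurent} {H₂ : Matrix (ι ⊕ β) ν BLaurent} {γ : ι → BLaurent}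
    (hH : H₁ * H₂ᴴ = paddedDiagonal α β γ) (i j : (ι ⊕ α) ⊕ (ι ⊕ β)) :
    shiftedSymp (extendedCheckMatrix H₁ H₂ γ i) (extendedCheckMatrix H₁ H₂ γ j) = 0 := by
  refine shiftedSymp_fromBlocks ?_ i j
  rw [Matrix.conjTranspose_fromCols_eq_fromRows_conjTranspose, Matrix.fromCols_mul_fromRows, hH]
  ext1 s t
  rcases s with s | s <;> rcases t with t | t <;>
    simp [Matrix.conjTranspose_fromRows_eq_fromCols_conjTranspose, CharTwo.add_self_eq_zero]

namespace EncodingFrame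

variable {n k c : ℕ} {α β : Type} {H₁ : Matrix (Fin c ⊕ α) (Fin n) BLaurent}
  {H₂ : Matrix (Fin c ⊕ β) (Fin n) BLaurent} {γ : Fin c → BLaurent} {E : Circuit (Fin n)}
  {D : Circuit (FrameQubits n c)}

/-- The composition of the sender's frame along the encoding frame `F`. -/
def layout (F : EncodingFrame H₁ H₂ γ (Fin k)) (w : Fin (n - k - c) ≃ α ⊕ β) : Layout n k c :=
  (((Equiv.refl _).sumCongr ((w.trans (Equiv.sumComm α β)).sumCongr (Equiv.refl _))).trans
    ((Equiv.sumAssoc _ _ _).symm.trans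
      ((Equiv.sumAssoc _ _ _).symm.sumCongr (Equiv.refl _)))).trans F.qubit

/-- The stabilizer generators that become the rows of `H₁` and of `H₂`. -/
def checkEquiv (w : Fin (n - k - c) ≃ α ⊕ β) :
    StabIndex n k c ≃ (Fin c ⊕ α) ⊕ (Fin c ⊕ β) :=
  ((Equiv.refl _).sumCongr w).trans (Equiv.sumSumSumComm _ _ _ _)

theorem initialStabilizer_checkEquiv_symm (F : EncodingFrame H₁ H₂ γ (Fin k))
    (w : Fin (n - k - c) ≃ α ⊕ β) (t : (Fin c ⊕ α) ⊕ (Fin c ⊕ β)) :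
    initialStabilizer (F.layout w) ((checkEquiv w).symm t) =
      Sum.elim
        (Sum.elim (fun a => joinRow (pauliZ a) (pauliZ (F.qubit (.inl (.inl (.inl a))))))
          fun b => joinRow 0 (pauliZ (F.qubit (.inl (.inr b)))))
        (Sum.elim (fun a => joinRow (pauliX a) (pauliX (F.qubit (.inl (.inl (.inl a))))))
          fun b => joinRow 0 (pauliZ (F.qubit (.inl (.inl (.inr b)))))) t := by
  rcases t with (a | b) | (a | b)
  · exact pauliZ_inl_add_pauliZ_inr _ _
  · simp [checkEquiv, initialStabilizer, layout, pauliZ_inr]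
  · exact pauliX_inl_add_pauliX_inr _ _
  · simp [checkEquiv, initialStabilizer, layout, pauliZ_inr]

namespace IsEncoder

variable {F : EncodingFrame H₁ H₂ γ (Fin k)}

theorem act_map_infoQubit_pauliZ (hE : F.IsEncoder E) (w : Fin (n - k - c) ≃ α ⊕ β) (i : Fin k) :
    Circuit.act (Circuit.map .inr E) (pauliZ (infoQubit (F.layout w) i)) =
      zRow (Sum.elim 0 (F.zRows (F.qubit (.inr i)))) := by
  rw [← joinRow_zRow, zRow_zero, ← hE.act_pauliZ_info, ← Circuit.act_map_inr, ← pauliZ_inr]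
  rfl

theorem act_map_infoQubit_pauliX (hE : F.IsEncoder E) (w : Fin (n - k - c) ≃ α ⊕ β) (i : Fin k) :
    Circuit.act (Circuit.map .inr E) (pauliX (infoQubit (F.layout w) i)) =
      xRow (Sum.elim (F.coupling i) (F.xRows (F.qubit (.inr i)))) +
        ∑ a, toRat (F.coupling i a) •
          Circuit.act (Circuit.map .inr E)
            (initialStabilizer (F.layout w) (.inl (.inr a))) := by
  have hzero : xRow (F.coupling i) + ∑ a, toRat (F.coupling i a) • pauliX a = 0 := by
    funext s
    rcases s with s | s <;>
      simp [xRow, pauliX, Finset.sum_apply, Pi.single_apply, CharTwo.add_self_eq_zero]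
  have hstab : ∀ a, initialStabilizer (F.layout w) (.inl (.inr a)) =
      joinRow (pauliX a) (pauliX (F.qubit (.inl (.inl (.inl a))))) := fun a =>
    F.initialStabilizer_checkEquiv_symm w (.inr (.inl a))
  simp only [hstab, Circuit.act_map_inr]
  rw [← joinRow_xRow, ← joinRow_add_sum_smul, hzero, ← hE.act_pauliX_info, ← Circuit.act_map_inr,
    ← pauliX_inr]
  rfl

theorem smul_act_map_initialStabilizer (hE : F.IsEncoder E) (w : Fin (n - k - c) ≃ α ⊕ β)
    (t : (Fin c ⊕ α) ⊕ (Fin c ⊕ β)) :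
    toRat (Sum.elim 1 (Sum.elim (star γ) 1) t) • Circuit.act (Circuit.map .inr E)
        (initialStabilizer (F.layout w) ((checkEquiv w).symm t)) =
      fun q => toRat (extendedCheckMatrix H₁ H₂ γ t q) := by
  rw [F.initialStabilizer_checkEquiv_symm, toRat_extendedCheckMatrix]
  rcases t with (a | b) | (a | b)
  · simp only [Sum.elim_inl, Pi.one_apply, map_one, one_smul]
    rw [Circuit.act_map_inr, hE.act_pauliZ_ebit, ← zRow_single_one, joinRow_zRow]
  · simp only [Sum.elim_inl, Sum.elim_inr, Pi.one_apply, map_one, one_smul]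
    rw [Circuit.act_map_inr, hE.act_pauliZ_zAncilla, ← zRow_zero, joinRow_zRow]
  · simp only [Sum.elim_inl, Sum.elim_inr, Pi.star_apply]
    rw [Circuit.act_map_inr, smul_joinRow, hE.smul_act_pauliX_ebit, ← xRow_single, joinRow_xRow]
  · simp only [Sum.elim_inr, Pi.one_apply, map_one, one_smul]
    rw [Circuit.act_map_inr, hE.act_pauliZ_xAncilla, ← xRow_zero, joinRow_xRow]

end IsEncoder

/-- The entanglement-assisted code with the encoding circuit `E` and the decoding circuit `D`. -/
noncomputable def code (F : EncodingFrame H₁ H₂ γ (Fin k)) (w : Fin (n - k - c) ≃ α ⊕ β)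
    (hE : F.IsEncoder E) (hD : F.IsDecoder D) : Code n k c where
  layout := F.layout w
  encoder := Circuit.map .inr E
  encoder_local := Circuit.qubits_subset_of_mem_map .inr
  decoder := D
  decoder_finiteDepth := hD.finiteDepth
  output := (Function.Embedding.inr.trans F.qubit.toEmbedding).trans .inr
  decodes_Z i := ⟨0, by
    rw [hE.act_map_infoQubit_pauliZ, hD.act_zRow]
    simp⟩
  decodes_X i := ⟨Sum.elim (Sum.elim 0 (F.coupling i)) 0, by
    rw [hE.act_map_infoQubit_pauliX, Circuit.act_add_sum_smul, hD.act_xRow]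
    simp [Fintype.sum_sum_type]⟩

theorem realizes_code (F : EncodingFrame H₁ H₂ γ (Fin k)) [Fintype α] [DecidableEq α] [Fintype β]
    [DecidableEq β] (hH : H₁ * H₂ᴴ = paddedDiagonal α β γ) (hγ : ∀ a, γ a ≠ 0)
    (w : Fin (n - k - c) ≃ α ⊕ β) (hE : F.IsEncoder E) (hD : F.IsDecoder D) :
    (F.code w hE hD).Realizes (Matrix.fromBlocks H₁ 0 0 H₂) := by
  let δ : (Fin c ⊕ α) ⊕ (Fin c ⊕ β) → BLaurent := Sum.elim 1 (Sum.elim (star γ) 1)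
  have hδ : ∀ t, toRat (δ t) ≠ 0 := fun t => by
    refine (map_ne_zero_iff toRat toRat_injective).mpr ?_
    rcases t with _ | a | _
    exacts [one_ne_zero, star_ne_zero.mpr (hγ a), one_ne_zero]
  refine ⟨extendedCheckMatrix H₁ H₂ γ, (Matrix.diagonal δ).submatrix id (checkEquiv w),
    (Matrix.diagonal fun t => (toRat (δ t))⁻¹).submatrix (checkEquiv w) id, ?_,
    shiftedSymp_extendedCheckMatrix hH, ?_, ?_, fun t => ?_⟩
  · rintro (i | i) <;> funext q <;> rcases q with q | q <;> rfl
  · rw [← Matrix.submatrix_map, Matrix.submatrix_mul_equiv, Matrix.diagonal_map (map_zero toRat),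
      Matrix.diagonal_mul_diagonal]
    simp [hδ]
  · rw [← Matrix.submatrix_map, ← Matrix.submatrix_mul _ _ _ _ _ Function.bijective_id,
      Matrix.diagonal_map (map_zero toRat), Matrix.diagonal_mul_diagonal]
    simp [hδ]
  · rw [← (checkEquiv w).symm.sum_comp]
    simp only [Matrix.submatrix_apply, Equiv.apply_symm_apply, Matrix.diagonal_apply, id]
    rw [← hE.smul_act_map_initialStabilizer w t]
    simp only [apply_ite toRat, map_zero, ite_smul, zero_smul, Finset.sum_ite_eq, Finset.mem_univ,
      ↓reduceIte]
    rfl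

end EncodingFrame

/-! ### Arbitrary check matrices -/

theorem shiftedSymp_sum_smul {Q ι κ : Type} [Fintype Q] [Fintype ι] [Fintype κ]
    (r : ι → BLaurent) (u : ι → Q ⊕ Q → BLaurent) (s : κ → BLaurent) (v : κ → Q ⊕ Q → BLaurent) :
    shiftedSymp (∑ i, r i • u i) (∑ j, s j • v j) =
      ∑ i, ∑ j, r i * star (s j) * shiftedSymp (u i) (v j) := by
  have hcoeff : ∀ q, (∑ i, r i • u i) q = ∑ i, r i * u i q := fun q => by
    simp only [Finset.sum_apply, Pi.smul_apply, smul_eq_mul]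
  have hstar : ∀ q, LaurentPolynomial.invert ((∑ j, s j • v j) q) =
      ∑ j, star (s j) * LaurentPolynomial.invert (v j q) := fun q => by
    simp only [Finset.sum_apply, Pi.smul_apply, smul_eq_mul, map_sum, map_mul]
    rfl
  simp only [shiftedSymp, hcoeff, hstar, Finset.sum_mul_sum, ← Finset.sum_add_distrib]
  rw [Finset.sum_comm]
  refine Finset.sum_congr rfl fun i _ => Finset.sum_comm.trans ?_
  refine Finset.sum_congr rfl fun j _ => ?_
  rw [Finset.mul_sum]
  exact Finset.sum_congr rfl fun q _ => by ring

theorem Code.Realizes.mul_left {n k c : ℕ} {C : Code n k c} {ι ι' : Type} [Fintype ι]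
    [DecidableEq ι] [Fintype ι'] [DecidableEq ι'] {H : Matrix ι (Fin n ⊕ Fin n) BLaurent}
    (h : C.Realizes H) {U : Matrix ι' ι BLaurent} {U' : Matrix ι ι' BLaurent} (hUU' : U * U' = 1)
    (hU'U : U' * U = 1) : C.Realizes (U * H) := by
  obtain ⟨G, R, R', hG, hsymp, hRR', hR'R, hR⟩ := h
  refine ⟨fun i => ∑ j, U i j • G j, U * R, R' * U'.map toRat, fun i => ?_, fun i i' => ?_, ?_, ?_,
    fun i => ?_⟩
  · funext q
    rcases q with q | q <;> simp [Matrix.mul_apply, ← hG, senderPart]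
  · simp [shiftedSymp_sum_smul, hsymp]
  · rw [Matrix.map_mul, Matrix.mul_assoc, ← Matrix.mul_assoc (R.map toRat), hRR', Matrix.one_mul,
      ← Matrix.map_mul, hUU', Matrix.map_one _ (map_zero _) (map_one _)]
  · rw [Matrix.map_mul, Matrix.mul_assoc, ← Matrix.mul_assoc (U'.map toRat), ← Matrix.map_mul,
      hU'U, Matrix.map_one _ (map_zero _) (map_one _), Matrix.one_mul, hR'R]
  · funext q
    have hq : ∀ j, toRat (G j q) = ∑ s, toRat (R j s) * C.stabilizer s q := fun j => by
      simpa [Finset.sum_apply] using congrFun (hR j) q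
    simp only [Finset.sum_apply, Pi.smul_apply, smul_eq_mul, map_sum, map_mul, hq,
      Matrix.mul_apply, Finset.mul_sum, Finset.sum_mul, mul_assoc]
    exact Finset.sum_comm

theorem exists_code_of_mul_conjTranspose_eq {n c a b : ℕ}
    {H₁ : Matrix (Fin c ⊕ Fin a) (Fin n) BLaurent} {H₂ : Matrix (Fin c ⊕ Fin b) (Fin n) BLaurent}
    {K₁ : Matrix (Fin n) (Fin c ⊕ Fin a) BLaurent} {K₂ : Matrix (Fin n) (Fin c ⊕ Fin b) BLaurent}
    (hK₁ : H₁ * K₁ = 1) (hK₂ : H₂ * K₂ = 1) {γ : Fin c → BLaurent} (hγ : ∀ i, γ i ≠ 0)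
    (hH : H₁ * H₂ᴴ = paddedDiagonal (Fin a) (Fin b) γ) :
    ∃ k, c + a + b + k = n ∧ ∃ C : Code n k c, C.Realizes (Matrix.fromBlocks H₁ 0 0 H₂) ∧
      ((∀ i, ∃ l, γ i = LaurentPolynomial.T l) → C.encoder.FiniteDepth) := by
  obtain ⟨k, ⟨F⟩⟩ := exists_encodingFrame hK₁ hK₂ hH
  have hk : c + b + a + k = n := by simpa using Fintype.card_congr F.qubit
  obtain ⟨E, hE, hfd⟩ := F.exists_isEncoder hγ
  obtain ⟨D, hD⟩ := F.exists_isDecoder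
  let w : Fin (n - k - c) ≃ Fin a ⊕ Fin b := Fintype.equivOfCardEq (by simp; omega)
  exact ⟨k, by omega, F.code w hE hD, F.realizes_code hH hγ w hE hD, fun h => (hfd h).map .inr⟩

theorem exists_code_of_hasSmithForm {r₁ r₂ n c a b : ℕ} {H₁ : Matrix (Fin r₁) (Fin n) BLaurent}
    {H₂ : Matrix (Fin r₂) (Fin n) BLaurent} {K₁ : Matrix (Fin n) (Fin r₁) BLaurent}
    {K₂ : Matrix (Fin n) (Fin r₂) BLaurent} (hK₁ : H₁ * K₁ = 1) (hK₂ : H₂ * K₂ = 1)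
    {γ : Fin c → BLaurent} (hγ : ∀ i, γ i ≠ 0)
    (hH : HasSmithForm (H₁ * H₂ᴴ) (Fin a) (Fin b) γ) :
    ∃ k, r₁ + r₂ + k = n + c ∧ ∃ C : Code n k c, C.Realizes (Matrix.fromBlocks H₁ 0 0 H₂) ∧
      ((∀ i, ∃ l, γ i = LaurentPolynomial.T l) → C.encoder.FiniteDepth) := by
  obtain ⟨hr₁, hr₂⟩ : r₁ = c + a ∧ r₂ = c + b := by simpa using hH.card_eq
  obtain ⟨A, A', B, B', hAA', hA'A, hBB', hB'B, hP⟩ := hH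
  have hBB'H : B'ᴴ * Bᴴ = 1 := by
    rw [← Matrix.conjTranspose_mul, hBB', Matrix.conjTranspose_one]
  have hB'BH : Bᴴ * B'ᴴ = 1 := by
    rw [← Matrix.conjTranspose_mul, hB'B, Matrix.conjTranspose_one]
  obtain ⟨k, hk, C, hC, hfd⟩ := exists_code_of_mul_conjTranspose_eq (H₁ := A' * H₁)
    (H₂ := B'ᴴ * H₂) (K₁ := K₁ * A) (K₂ := K₂ * Bᴴ)
    (by rw [Matrix.mul_assoc, ← Matrix.mul_assoc H₁, hK₁, Matrix.one_mul, hA'A])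
    (by rw [Matrix.mul_assoc, ← Matrix.mul_assoc H₂, hK₂, Matrix.one_mul, hBB'H]) hγ (by
      rw [Matrix.conjTranspose_mul, Matrix.conjTranspose_conjTranspose, Matrix.mul_assoc,
        ← Matrix.mul_assoc H₁, hP, Matrix.mul_assoc _ B, hBB', Matrix.mul_one, ← Matrix.mul_assoc,
        hA'A, Matrix.one_mul])
  refine ⟨k, by omega, C, ?_, hfd⟩
  have hC' := hC.mul_left (U := Matrix.fromBlocks A 0 0 Bᴴ) (U' := Matrix.fromBlocks A' 0 0 B'ᴴ)
    (by simp [Matrix.fromBlocks_multiply, hAA', hB'BH])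
    (by simp [Matrix.fromBlocks_multiply, hA'A, hBB'H])
  simpa [Matrix.fromBlocks_multiply, ← Matrix.mul_assoc, hAA', hB'BH] using hC'

end EAQC

theorem mainTheorem1_general (n r₁ r₂ c : ℕ) (H₁ : Matrix (Fin r₁) (Fin n) (ZMod 2)[X])
    (H₂ : Matrix (Fin r₂) (Fin n) (ZMod 2)[X]) (hnc₁ : EAQC.Noncatastrophic H₁)
    (hnc₂ : EAQC.Noncatastrophic H₂) (hc : c = EAQC.ratRank (EAQC.overlap H₁ H₂)) :
    ∃ k, r₁ + r₂ + k = n + c ∧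
      (∃ C : EAQC.Code n k c, C.Realizes (EAQC.cssCheckMatrix H₁ H₂)) ∧
      (EAQC.HasMonomialSmithForm (EAQC.overlap H₁ H₂) c →
        ∃ C : EAQC.Code n k c,
          C.Realizes (EAQC.cssCheckMatrix H₁ H₂) ∧ C.encoder.FiniteDepth) := by
  obtain ⟨K₁, hK₁⟩ := hnc₁.exists_right_inverse
  obtain ⟨K₂, hK₂⟩ := hnc₂.exists_right_inverse
  obtain ⟨s, a, b, γ, hγ, hP⟩ := EAQC.exists_hasSmithForm (EAQC.overlap H₁ H₂)
  obtain rfl : c = s := by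
    rw [hc, EAQC.ratRank_eq_card_of_hasSmithForm hP hγ, Fintype.card_fin]
  obtain ⟨k, hk, C, hC, -⟩ := EAQC.exists_code_of_hasSmithForm hK₁ hK₂ hγ hP
  refine ⟨k, hk, ⟨C, hC⟩, fun hmono => ?_⟩
  obtain ⟨rfl, rfl⟩ : r₁ = c + a ∧ r₂ = c + b := by simpa using hP.card_eq
  obtain ⟨l, hl⟩ := hmono.exists_hasSmithForm
  obtain ⟨k', hk', C', hC', hfd⟩ := EAQC.exists_code_of_hasSmithForm hK₁ hK₂
    (fun i => (LaurentPolynomial.isUnit_T (l i)).ne_zero) hl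
  obtain rfl : k' = k := by omega
  exact ⟨C', hC', hfd fun i => ⟨l i, rfl⟩⟩

theorem mainTheorem1 (n k₁ k₂ : ℕ) (hk₁ : k₁ ≤ n) (hk₂ : k₂ ≤ n)
    (H₁ : Matrix (Fin (n - k₁)) (Fin n) (ZMod 2)[X])
    (H₂ : Matrix (Fin (n - k₂)) (Fin n) (ZMod 2)[X])
    (hnc₁ : EAQC.Noncatastrophic H₁) (hdf₁ : EAQC.DelayFree H₁)
    (hnc₂ : EAQC.Noncatastrophic H₂) (hdf₂ : EAQC.DelayFree H₂)
    (c : ℕ) (hc : c = EAQC.ratRank (EAQC.overlap H₁ H₂)) :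
    n ≤ k₁ + k₂ + c ∧
    (∃ C : EAQC.Code n (k₁ + k₂ + c - n) c,
      C.Realizes (EAQC.cssCheckMatrix H₁ H₂)) ∧
    (EAQC.HasMonomialSmithForm (EAQC.overlap H₁ H₂) c →
      ∃ C : EAQC.Code n (k₁ + k₂ + c - n) c,
        C.Realizes (EAQC.cssCheckMatrix H₁ H₂) ∧ C.encoder.FiniteDepth) := by
  obtain ⟨k, hk, h⟩ := mainTheorem1_general n _ _ c H₁ H₂ hnc₁ hnc₂ hc
  obtain rfl : k = k₁ + k₂ + c - n := by omega
  exact ⟨by omega, h⟩
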